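/- **Setting.** For $s\in\mathcal S(\mathbb R)$ (real-valued Schwartz functions) let $\|s\|^2=\int_{\mathbb R}s(x)^2\,dx$. Let $\varphi$ be a function of class $ML$: $\varphi:\mathbb C\to\mathbb C$ is entire, $\varphi(0)=1$, $\varphi'(0)>0$, the kernel $\varphi(z\overline w)$ is positive definite on $\mathbb C$, and the kernel $(s_1,s_2)\mapsto\varphi(-\|s_1-s_2\|^2/2)$ is positive definite on $\mathcal S(\mathbb R)$. Let $P_\varphi$ be the probability measure on the cylindrical $\sigma$-algebra $\mathcal C$ of the space $\mathcal S'(\mathbb R)$ of real tempered distributions with $$\int_{\mathcal S'(\mathbb R)}e^{i\langle\omega,s\rangle}\,dP_\varphi(\omega)=\varphi\!\left(-\tfrac{\|s\|^2}{2}\right),\qquad s\in\mathcal S(\mathbb R).$$ Let $\zeta_1,\zeta_2,\dots$ be the normalized Hermite functions, $\zeta_{n+1}(x)=\pi^{-1/4}(n!)^{-1/2}\,\mathrm{He}_n(\sqrt2\,x)\,e^{-x^2/2}$ for $n\ge0$ (with $\mathrm{He}_n$ the probabilists' Hermite polynomials), and for a finitely supported multi-index $\gamma=(\gamma_1,\gamma_2,\dots)$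 of non-negative integers put $Q^\gamma(\omega)=\prod_j\langle\omega,\zeta_j\rangle^{\gamma_j}$. The functions $\tilde Q^\gamma$ are constructed in stages. Stage $1$ consists of the indices $(\gamma_1,0,0,\dots)$, $\gamma_1\ge0$; stage $N+1$ ($N\ge1$) consists of the indices $(\gamma_1,\dots,\gamma_{N+1},0,\dots)$ with $\gamma_{N+1}\ge1$. Choose, for every stage, an enumeration of its indices by $\mathbb N$. At stage $1$ apply Gram–Schmidt and normalization to the sequence of the $Q^\gamma$. At stage $N+1$ project the $Q^\gamma$ of that stage onto $(\mathcal H_1\oplus\dots\oplus\mathcal H_N)^\perp$ and apply Gram–Schmidt and normalization to the resulting sequence. Here $\mathcal H_j$ is the closed linear span of the $\tilde Q^\gamma$ of stage $j$ in $L^2(\mathcal S'(\mathbb R),\mathcal C,P_\varphi;\mathbb C)$. In general the $\tilde Q^\gamma$ of the later stages are $L^2$-limits of polynomials in the $\langle\omega,\zeta_j\rangle$. **Theorem.** All $Q^\gamma$ belong to $L^2(\mathcal S'(\mathbb R),\mathcal C,P_\varphi;\mathbb C)$, and, for every choice of the enumerations, the family $(\tilde Q^\gamma)_\gamma$ is an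 orthonormal basis of this space. Hence every $f\in L^2(\mathcal S'(\mathbb R),\mathcal C,P_\varphi;\mathbb C)$ has a unique expansion $$f=\sum_\gamma c_\gamma\,\tilde Q^\gamma,\qquad c_\gamma\in\mathbb C,$$ converging unconditionally in $L^2$ (a generalized Wiener–Itô chaos expansion). The same two assertions hold for the orthonormal polynomials obtained from all the $Q^\gamma$ in a single run of Gram–Schmidt and normalization along any enumeration of the multi-indices by $\mathbb N$. -/

import Mathlib

open MeasureTheory Polynomial
open scoped SchwartzMap ContDiff

namespace GreyNoise

/-! ### Hermite functions as Schwartz functions -/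

theorem contDiff_polyGauss (p : ℝ[X]) :
    ContDiff ℝ ∞ (fun x : ℝ => p.eval x * Real.exp (-(x ^ 2 / 2))) := by
  have h : ContDiff ℝ ∞ (fun x : ℝ => p.eval x) := by
    simpa [Polynomial.aeval_def, Polynomial.eval₂_eq_eval_map] using
      (Polynomial.contDiff_aeval (𝕜 := ℝ) p ∞)
  fun_prop

theorem iteratedDeriv_polyGauss (n : ℕ) (p : ℝ[X]) :
    ∃ q : ℝ[X], iteratedDeriv n (fun x : ℝ => p.eval x * Real.exp (-(x ^ 2 / 2))) =
      fun x : ℝ => q.eval x * Real.exp (-(x ^ 2 / 2)) := by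
  induction n generalizing p with
  | zero => exact ⟨p, by simp⟩
  | succ n ih =>
    obtain ⟨q, hq⟩ := ih (derivative p - X * p)
    refine ⟨q, ?_⟩
    rw [iteratedDeriv_succ', ← hq]
    congr 1
    funext x
    have h1 : HasDerivAt (fun x : ℝ => -(x ^ 2 / 2)) (-x) x := by
      have h : HasDerivAt (fun x : ℝ => -(x ^ 2 / 2)) _ x := ((hasDerivAt_pow 2 x).div_const 2).neg
      exact h.congr_deriv (by norm_num)
    have h2 := (p.hasDerivAt x).mul h1.exp
    have h3 : HasDerivAt (fun x : ℝ => p.eval x * Real.exp (-(x ^ 2 / 2))) _ x := h2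
    rw [h3.deriv]
    simp
    ring

theorem bounded_polyGauss (p : ℝ[X]) :
    ∃ C : ℝ, ∀ x : ℝ, ‖p.eval x * Real.exp (-(x ^ 2 / 2))‖ ≤ C := by
  induction p using Polynomial.induction_on' with
  | add p q hp hq =>
    obtain ⟨C, hC⟩ := hp
    obtain ⟨D, hD⟩ := hq
    refine ⟨C + D, fun x => ?_⟩
    rw [eval_add, add_mul]
    exact (norm_add_le _ _).trans (add_le_add (hC x) (hD x))
  | monomial m a =>
    refine ⟨|a| * (m.factorial * Real.exp (1 / 2)), fun x => ?_⟩
    have h1 : |x| ^ m / m.factorial ≤ Real.exp |x| :=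
      Real.pow_div_factorial_le_exp |x| (abs_nonneg x) m
    have h2 : |x| ^ m ≤ m.factorial * Real.exp |x| := by
      rw [div_le_iff₀ (by positivity)] at h1
      linarith
    have h3 : Real.exp |x| * Real.exp (-(x ^ 2 / 2)) ≤ Real.exp (1 / 2) := by
      rw [← Real.exp_add]
      apply Real.exp_le_exp.mpr
      nlinarith [sq_nonneg (|x| - 1), sq_abs x]
    rw [eval_monomial, norm_mul, norm_mul, norm_pow, Real.norm_eq_abs, Real.norm_eq_abs,
      Real.norm_eq_abs, abs_of_pos (Real.exp_pos _), mul_assoc]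
    apply mul_le_mul_of_nonneg_left _ (abs_nonneg a)
    calc |x| ^ m * Real.exp (-(x ^ 2 / 2))
        ≤ (m.factorial * Real.exp |x|) * Real.exp (-(x ^ 2 / 2)) := by gcongr
      _ = m.factorial * (Real.exp |x| * Real.exp (-(x ^ 2 / 2))) := by ring
      _ ≤ m.factorial * Real.exp (1 / 2) := by gcongr

/-- The Schwartz function `x ↦ p(x) e^{-x²/2}`, for a real polynomial `p`. -/
noncomputable def polyGauss (p : ℝ[X]) : 𝓢(ℝ, ℝ) where
  toFun := fun x : ℝ => p.eval x * Real.exp (-(x ^ 2 / 2))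
  smooth' := contDiff_polyGauss p
  decay' := by
    intro k n
    obtain ⟨q, hq⟩ := iteratedDeriv_polyGauss n p
    obtain ⟨C, hC⟩ := bounded_polyGauss (X ^ k * q)
    refine ⟨C, fun x => ?_⟩
    rw [norm_iteratedFDeriv_eq_norm_iteratedDeriv, hq, ← norm_pow, ← norm_mul]
    simpa [mul_assoc] using hC x

/-- The normalized Hermite function
`ζ_n(x) = π^{-1/4} (n!)^{-1/2} He_n(√2 x) e^{-x²/2}`, `n = 0, 1, 2, …`, where `He_n` is the
probabilists' Hermite polynomial. -/
noncomputable def hermiteFun (n : ℕ) : 𝓢(ℝ, ℝ) :=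
  (Real.sqrt (n.factorial * Real.sqrt Real.pi))⁻¹ •
    polyGauss (((hermite n).map (Int.castRingHom ℝ)).comp (C (Real.sqrt 2) * X))

theorem hermiteFun_apply (n : ℕ) (x : ℝ) :
    hermiteFun n x = (Real.sqrt (n.factorial * Real.sqrt Real.pi))⁻¹ *
      (aeval (Real.sqrt 2 * x) (hermite n) * Real.exp (-(x ^ 2 / 2))) := by
  have h : polyGauss (((hermite n).map (Int.castRingHom ℝ)).comp (C (Real.sqrt 2) * X)) x =
      aeval (Real.sqrt 2 * x) (hermite n) * Real.exp (-(x ^ 2 / 2)) := by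
    change eval x _ * _ = _
    simp [eval_comp, aeval_def, eval₂_eq_eval_map]
  rw [hermiteFun, smul_apply, h, smul_eq_mul]

/-! ### The class `ML` -/

open scoped ComplexOrder in
/-- A kernel `K : X × X → ℂ` is positive definite if all its finite sections are positive
semidefinite matrices. -/
def IsPosDefKernel {X : Type*} (K : X → X → ℂ) : Prop :=
  ∀ (n : ℕ) (x : Fin n → X), (Matrix.of fun i j => K (x i) (x j)).PosSemidef

/-- The squared norm of `s` in `L²(ℝ, dx)`. -/
noncomputable def normSqL2 (s : 𝓢(ℝ, ℝ)) : ℝ := ∫ x, s x ^ 2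

/-- The function `s ↦ φ(-‖s‖² / 2)` on the Schwartz space. -/
noncomputable def charFunctional (φ : ℂ → ℂ) (s : 𝓢(ℝ, ℝ)) : ℂ :=
  φ (((-(normSqL2 s) / 2 : ℝ)) : ℂ)

/-- The class `ML` of entire functions. -/
structure IsML (φ : ℂ → ℂ) : Prop where
  entire : Differentiable ℂ φ
  map_zero : φ 0 = 1
  deriv_zero : ∃ r : ℝ, 0 < r ∧ deriv φ 0 = (r : ℂ)
  posDef_complex : IsPosDefKernel fun z w : ℂ => φ (z * (starRingEnd ℂ) w)
  posDef_schwartz : IsPosDefKernel fun s₁ s₂ : 𝓢(ℝ, ℝ) => charFunctional φ (s₁ - s₂)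

/-! ### The probability space -/

/-- The space `S'(ℝ)` of real-valued tempered distributions. -/
def RealDistribution : Type := 𝓢(ℝ, ℝ) →L[ℝ] ℝ

/-- The random variable `Q_s(T) = ⟨T, s⟩`. -/
noncomputable def Q (s : 𝓢(ℝ, ℝ)) (T : RealDistribution) : ℝ :=
  (show 𝓢(ℝ, ℝ) →L[ℝ] ℝ from T) s

/-- The cylindrical sigma-algebra: the smallest one making all `Q_s` measurable. -/
noncomputable instance : MeasurableSpace RealDistribution :=
  ⨆ s : 𝓢(ℝ, ℝ), MeasurableSpace.comap (Q s) inferInstance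

/-- `P` is the probability measure `P_φ`: its characteristic functional is `φ(-‖s‖² / 2)`. -/
structure IsPφ (φ : ℂ → ℂ) (P : Measure RealDistribution) : Prop where
  isProbabilityMeasure : IsProbabilityMeasure P
  charFunctional_eq : ∀ s : 𝓢(ℝ, ℝ),
    charFunctional φ s = ∫ T, Complex.exp (Complex.I * (Q s T : ℂ)) ∂P

/-! ### Monomials and their orthonormalization

A multi-index is `γ : ℕ →₀ ℕ`; variables are numbered from `0`. -/

/-- The monomial `Q^γ(T) = ∏_j ⟨T, ζ_j⟩^{γ_j}`. -/
noncomputable def monomialFun (γ : ℕ →₀ ℕ) (T : RealDistribution) : ℂ :=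
  γ.prod fun j k => (Q (hermiteFun j) T : ℂ) ^ k

open Classical in
/-- The class of `Q^γ` in `L²(S'(ℝ), C, P; ℂ)` (and `0` should `Q^γ` not be square integrable). -/
noncomputable def monomialL2 (P : Measure RealDistribution) (γ : ℕ →₀ ℕ) : Lp ℂ 2 P :=
  if h : MemLp (monomialFun γ) 2 P then h.toLp (monomialFun γ) else 0

/-- The stage at which `γ` enters the orthogonalization: the largest `j` with `γ_j ≠ 0`
(and `0` for `γ = 0`).  So stage `0` consists of all `(γ_0, 0, 0, …)`, and stage `n + 1` of all
`(γ_0, …, γ_{n+1}, 0, …)` with `γ_{n+1} ≥ 1`. -/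
def stage (γ : ℕ →₀ ℕ) : ℕ := γ.support.sup id

/-- An order (of type `ω`), for every stage, in which the monomials of that stage are
orthogonalized. -/
abbrev StageEnumeration : Type := ∀ n : ℕ, ℕ ≃ {γ : ℕ →₀ ℕ // stage γ = n}

/-- One stage: Gram–Schmidt with normalization, applied to the projections onto `Sᗮ` of the
monomials `Q^{e 0}, Q^{e 1}, …`. -/
noncomputable def stageFamily (P : Measure RealDistribution) (S : Submodule ℂ (Lp ℂ 2 P))
    {n : ℕ} (e : ℕ ≃ {γ : ℕ →₀ ℕ // stage γ = n}) : ℕ → Lp ℂ 2 P :=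
  InnerProductSpace.gramSchmidtNormed ℂ fun k => Sᗮ.starProjection (monomialL2 P (e k).1)

/-- The closed subspace `H_0 ⊕ … ⊕ H_{n-1}` produced by the stages before stage `n`. -/
noncomputable def previousStages (P : Measure RealDistribution) (e : StageEnumeration) :
    ℕ → Submodule ℂ (Lp ℂ 2 P)
  | 0 => ⊥
  | n + 1 => (previousStages P e n ⊔
      Submodule.span ℂ (Set.range (stageFamily P (previousStages P e n) (e n)))).topologicalClosure

/-- The functions `Q̃^γ` obtained by the stage-by-stage orthogonalization. -/
noncomputable def Qtilde (P : Measure RealDistribution) (e : StageEnumeration)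
    (γ : ℕ →₀ ℕ) : Lp ℂ 2 P :=
  stageFamily P (previousStages P e (stage γ)) (e (stage γ)) ((e (stage γ)).symm ⟨γ, rfl⟩)

/-- The polynomials obtained from all `Q^γ` by one run of Gram–Schmidt with normalization, along
an enumeration `e` of all multi-indices. -/
noncomputable def QtildePoly (P : Measure RealDistribution) (e : ℕ ≃ (ℕ →₀ ℕ))
    (γ : ℕ →₀ ℕ) : Lp ℂ 2 P :=
  InnerProductSpace.gramSchmidtNormed ℂ (fun k => monomialL2 P (e k)) (e.symm γ)

/-- `v` is an orthonormal basis of the Hilbert space `E`: orthonormal with dense linear span. -/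
def IsOrthonormalBasis {ι E : Type*} [NormedAddCommGroup E] [InnerProductSpace ℂ E]
    (v : ι → E) : Prop :=
  Orthonormal ℂ v ∧ (Submodule.span ℂ (Set.range v)).topologicalClosure = ⊤

end GreyNoise

/-! Two facts carry the proof: polynomials in the coordinates are dense in L², and the vectors fed
to Gram–Schmidt are linearly independent.

Density. The Taylor series of φ at 0 turns t ↦ E cos(t Q_s) into an everywhere convergent power
series. Its coefficients give the even moments of Q_s (`integral_even_pow`), and their decay gives
all exponential moments of |Q_s|. If f is orthogonal to the polynomials, the exponential series may
be integrated termwise, so f is orthogonal to e^{iQ_s} for s in the span of the Hermite functions.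
That span is dense in L²(ℝ), and s ↦ e^{iQ_s} is continuous for the L²(ℝ) norm, so f is orthogonal
to every e^{iQ_s}; uniqueness of characteristic functions gives f = 0.

Independence. The characteristic functional depends on ‖s‖ only, so rotating an orthonormal family
preserves its joint law (`map_Q_eq_of_orthonormal`). The measure may charge the zero distribution,
as for φ(z) = (1 + e^z)/2, hence polynomials are tested only where a coordinate is nonzero. Rotating
such a coordinate against another one sweeps out an interval while the remaining coordinates stay
frozen, which reduces a polynomial identity to one variable (`eq_zero_of_ae_eval_mul_Q`).

A single Gram–Schmidt run needs just this. The stages need more: no nonzero combination of stage n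
monomials may be an L²-limit of polynomials in the earlier variables. Rotating variable n against a
fresh coordinate fixes the earlier variables, hence also such a limit, so the combination cannot
depend on variable n (`coeff_finSuccEquiv_eq_zero`). For n ≥ 1 every stage n monomial contains that
variable, so the combination is zero. -/

namespace GreyNoise

/-! ### Taylor remainders of the cosine -/

/-- The remainder `(-1)^m (cos x - ∑_{k<m} (-1)^k x^{2k} / (2k)!)`. -/
noncomputable def cosRem (m : ℕ) (x : ℝ) : ℝ :=
  (-1) ^ m * (Real.cos x - ∑ k ∈ Finset.range m, (-1) ^ k * (x ^ (2 * k) / (2 * k).factorial))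

/-- The remainder `(-1)^m (sin x - ∑_{k<m} (-1)^k x^{2k+1} / (2k+1)!)`. -/
noncomputable def sinRem (m : ℕ) (x : ℝ) : ℝ :=
  (-1) ^ m * (Real.sin x -
    ∑ k ∈ Finset.range m, (-1) ^ k * (x ^ (2 * k + 1) / (2 * k + 1).factorial))

theorem cosRem_succ (m : ℕ) (x : ℝ) :
    cosRem (m + 1) x = x ^ (2 * m) / (2 * m).factorial - cosRem m x := by
  have h : ((-1 : ℝ) ^ m) * (-1) ^ m = 1 := by rw [← mul_pow]; simp
  simp only [cosRem, Finset.sum_range_succ, pow_succ]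
  linear_combination (x ^ (2 * m) / (2 * m).factorial) * h

theorem cosRem_succ_zero (m : ℕ) : cosRem (m + 1) 0 = 0 := by
  simp [cosRem, Finset.sum_range_succ']

theorem sinRem_zero (m : ℕ) : sinRem m 0 = 0 := by
  simp [sinRem]

theorem hasDerivAt_pow_div_factorial (n : ℕ) (x : ℝ) :
    HasDerivAt (fun x : ℝ => x ^ (n + 1) / (n + 1).factorial) (x ^ n / n.factorial) x := by
  refine ((hasDerivAt_pow (n + 1) x).div_const _).congr_deriv ?_
  rw [Nat.factorial_succ]
  have : (n.factorial : ℝ) ≠ 0 := by positivity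
  push_cast
  field_simp

theorem hasDerivAt_sinRem (m : ℕ) (x : ℝ) : HasDerivAt (sinRem m) (cosRem m x) x := by
  have h : HasDerivAt (fun x : ℝ =>
      ∑ k ∈ Finset.range m, (-1) ^ k * (x ^ (2 * k + 1) / (2 * k + 1).factorial))
      (∑ k ∈ Finset.range m, (-1) ^ k * (x ^ (2 * k) / (2 * k).factorial)) x :=
    HasDerivAt.fun_sum fun k _ => (hasDerivAt_pow_div_factorial (2 * k) x).const_mul _
  exact ((Real.hasDerivAt_sin x).sub h).const_mul ((-1) ^ m)

theorem hasDerivAt_cosRem_succ (m : ℕ) (x : ℝ) :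
    HasDerivAt (cosRem (m + 1)) (sinRem m x) x := by
  have h : HasDerivAt (fun x : ℝ =>
      ∑ k ∈ Finset.range (m + 1), (-1) ^ k * (x ^ (2 * k) / (2 * k).factorial))
      (∑ k ∈ Finset.range m, (-1) ^ (k + 1) * (x ^ (2 * k + 1) / (2 * k + 1).factorial)) x := by
    have h1 : HasDerivAt (fun x : ℝ =>
        ∑ k ∈ Finset.range m, (-1) ^ (k + 1) * (x ^ (2 * k + 1 + 1) / (2 * k + 1 + 1).factorial))
        (∑ k ∈ Finset.range m, (-1) ^ (k + 1) * (x ^ (2 * k + 1) / (2 * k + 1).factorial)) x :=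
      HasDerivAt.fun_sum fun k _ => (hasDerivAt_pow_div_factorial (2 * k + 1) x).const_mul _
    simp_rw [Finset.sum_range_succ', mul_zero, pow_zero]
    exact h1.add_const _
  refine (((Real.hasDerivAt_cos x).sub h).const_mul ((-1) ^ (m + 1))).congr_deriv ?_
  simp only [sinRem, pow_succ, mul_neg_one, neg_mul, Finset.sum_neg_distrib]
  ring

theorem cosRem_neg (m : ℕ) (x : ℝ) : cosRem m (-x) = cosRem m x := by
  simp [cosRem, pow_mul]

theorem cosRem_succ_nonneg_of_sinRem {m : ℕ} (h : ∀ x : ℝ, 0 ≤ x → 0 ≤ sinRem m x) (x : ℝ) :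
    0 ≤ cosRem (m + 1) x := by
  wlog hx : 0 ≤ x generalizing x
  · rw [← cosRem_neg]
    exact this (-x) (by linarith)
  have hm : MonotoneOn (cosRem (m + 1)) (Set.Ici 0) := by
    refine monotoneOn_of_deriv_nonneg (convex_Ici 0)
      (fun y _ => (hasDerivAt_cosRem_succ m y).continuousAt.continuousWithinAt)
      (fun y _ => (hasDerivAt_cosRem_succ m y).differentiableAt.differentiableWithinAt) ?_
    intro y hy
    rw [(hasDerivAt_cosRem_succ m y).deriv]
    rw [interior_Ici] at hy
    exact h y (le_of_lt hy)
  rw [← cosRem_succ_zero m]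
  exact hm (Set.mem_Ici.2 le_rfl) (Set.mem_Ici.2 hx) hx

theorem sinRem_nonneg_of_cosRem {m : ℕ} (h : ∀ x : ℝ, 0 ≤ cosRem m x) (x : ℝ) (hx : 0 ≤ x) :
    0 ≤ sinRem m x := by
  have hm : Monotone (sinRem m) := monotone_of_deriv_nonneg
    (fun y => (hasDerivAt_sinRem m y).differentiableAt)
    fun y => by rw [(hasDerivAt_sinRem m y).deriv]; exact h y
  rw [← sinRem_zero m]
  exact hm hx

/-- Start from cos ≤ 1 and integrate twice per step, from cosine to sine remainder and back. The
index is shifted because `cosRem 0` is the cosine, which changes sign. -/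
theorem cosRem_succ_nonneg (m : ℕ) (x : ℝ) : 0 ≤ cosRem (m + 1) x := by
  induction m generalizing x with
  | zero => simpa [cosRem] using Real.cos_le_one x
  | succ m ih => exact cosRem_succ_nonneg_of_sinRem (sinRem_nonneg_of_cosRem ih) x

theorem cosRem_le (m : ℕ) (x : ℝ) : cosRem m x ≤ x ^ (2 * m) / (2 * m).factorial := by
  have h := cosRem_succ_nonneg m x
  rw [cosRem_succ] at h
  linarith

/-- The rescaled remainder converges to the first omitted Taylor term. -/
theorem tendsto_cosRem_div {t : ℕ → ℝ} (ht : Filter.Tendsto t Filter.atTop (nhds 0))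
    (ht0 : ∀ n, t n ≠ 0) (m : ℕ) (x : ℝ) :
    Filter.Tendsto (fun n => cosRem m (t n * x) / t n ^ (2 * m)) Filter.atTop
      (nhds (x ^ (2 * m) / (2 * m).factorial)) := by
  have hb : Filter.Tendsto (fun n => x ^ (2 * m) / (2 * m).factorial -
      t n ^ 2 * (x ^ (2 * (m + 1)) / (2 * (m + 1)).factorial)) Filter.atTop
      (nhds (x ^ (2 * m) / (2 * m).factorial)) := by
    simpa using ((ht.pow 2).mul_const (x ^ (2 * (m + 1)) / (2 * (m + 1)).factorial)).const_sub
      (x ^ (2 * m) / (2 * m).factorial)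
  refine tendsto_of_tendsto_of_tendsto_of_le_of_le hb tendsto_const_nhds (fun n => ?_) fun n => ?_
  · have hp : 0 < t n ^ (2 * m) := by rw [pow_mul]; have := ht0 n; positivity
    have h := cosRem_le (m + 1) (t n * x)
    rw [cosRem_succ] at h
    simp only
    rw [le_div_iff₀ hp]
    have e1 : (t n * x) ^ (2 * m) / (2 * m).factorial =
      x ^ (2 * m) / (2 * m).factorial * t n ^ (2 * m) := by ring
    have e2 : (t n * x) ^ (2 * (m + 1)) / (2 * (m + 1)).factorial =
      t n ^ 2 * (x ^ (2 * (m + 1)) / (2 * (m + 1)).factorial) * t n ^ (2 * m) := by ring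
    rw [e1, e2] at h
    linarith
  · have hp : 0 < t n ^ (2 * m) := by rw [pow_mul]; have := ht0 n; positivity
    simp only
    rw [div_le_iff₀ hp]
    refine (cosRem_le m _).trans (le_of_eq ?_)
    ring

/-! ### Moments from an entire characteristic function -/

section Moments

variable {Ω : Type*} [MeasurableSpace Ω] {μ : Measure Ω} {Y : Ω → ℝ}
  {b : ℕ → ℝ}

/-- Fatou's lemma, in the form used to create integrability of moments and of cosh. -/
theorem integrable_of_tendsto_integral {F : ℕ → Ω → ℝ} {f : Ω → ℝ} {c : ℝ}
    (hF : ∀ n, Integrable (F n) μ) (h0 : ∀ n u, 0 ≤ F n u)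
    (hlim : ∀ u, Filter.Tendsto (fun n => F n u) Filter.atTop (nhds (f u)))
    (hc : Filter.Tendsto (fun n => ∫ u, F n u ∂μ) Filter.atTop (nhds c)) : Integrable f μ := by
  have hf : AEStronglyMeasurable f μ :=
    aestronglyMeasurable_of_tendsto_ae _ (fun n => (hF n).aestronglyMeasurable) (ae_of_all _ hlim)
  have hf0 : ∀ u, 0 ≤ f u := fun u => ge_of_tendsto' (hlim u) fun n => h0 n u
  refine ⟨hf, ?_⟩
  rw [hasFiniteIntegral_iff_ofReal (ae_of_all _ hf0)]
  have h1 : ∀ u, ENNReal.ofReal (f u) =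
      Filter.liminf (fun n => ENNReal.ofReal (F n u)) Filter.atTop := fun u =>
    (ENNReal.tendsto_ofReal (hlim u)).liminf_eq.symm
  simp_rw [h1]
  refine (lintegral_liminf_le' fun n => (hF n).aemeasurable.ennreal_ofReal).trans_lt ?_
  have h2 : ∀ n, ∫⁻ u, ENNReal.ofReal (F n u) ∂μ = ENNReal.ofReal (∫ u, F n u ∂μ) := fun n =>
    (ofReal_integral_eq_lintegral_ofReal (hF n) (ae_of_all _ (h0 n))).symm
  simp_rw [h2]
  rw [(ENNReal.tendsto_ofReal hc).liminf_eq]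
  exact ENNReal.ofReal_lt_top

/-- Once the moments below 2m are known, the subtracted Taylor polynomial integrates to exactly the
first m terms of the series, leaving its tail. -/
theorem integral_cosRem_mul [IsProbabilityMeasure μ] (hY : Measurable Y)
    (hcos : ∀ t : ℝ, HasSum (fun m => (-1) ^ m * (b m * t ^ (2 * m))) (∫ u, Real.cos (t * Y u) ∂μ))
    (m : ℕ) (ih : ∀ k < m, Integrable (fun u => Y u ^ (2 * k)) μ ∧
      ∫ u, Y u ^ (2 * k) ∂μ = (2 * k).factorial * b k) (t : ℝ) :
    Integrable (fun u => cosRem m (t * Y u)) μ ∧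
      HasSum (fun j => (-1) ^ j * (b (j + m) * t ^ (2 * j)) * t ^ (2 * m))
        (∫ u, cosRem m (t * Y u) ∂μ) := by
  have hic : Integrable (fun u => Real.cos (t * Y u)) μ :=
    Integrable.of_bound (by fun_prop) 1 (ae_of_all _ fun u => Real.abs_cos_le_one _)
  have hi : ∀ k ∈ Finset.range m, Integrable (fun u =>
      (-1) ^ k * ((t * Y u) ^ (2 * k) / (2 * k).factorial)) μ := by
    intro k hk
    simp_rw [mul_pow]
    exact (((ih k (Finset.mem_range.1 hk)).1.const_mul _).div_const _).const_mul _
  have hiv : ∀ k ∈ Finset.range m, ∫ u,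
      (-1) ^ k * ((t * Y u) ^ (2 * k) / (2 * k).factorial) ∂μ = (-1) ^ k * (b k * t ^ (2 * k)) := by
    intro k hk
    simp_rw [mul_pow]
    rw [integral_const_mul, integral_div, integral_const_mul, (ih k (Finset.mem_range.1 hk)).2]
    have : ((2 * k).factorial : ℝ) ≠ 0 := by positivity
    field_simp
  have hs : Integrable (fun u => ∑ k ∈ Finset.range m,
      (-1) ^ k * ((t * Y u) ^ (2 * k) / (2 * k).factorial)) μ := integrable_finsetSum _ hi
  refine ⟨(hic.sub hs).const_mul _, ?_⟩
  have e : ∫ u, cosRem m (t * Y u) ∂μ = (-1) ^ m * (∫ u, Real.cos (t * Y u) ∂μ -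
      ∑ k ∈ Finset.range m, (-1) ^ k * (b k * t ^ (2 * k))) := by
    simp only [cosRem]
    rw [integral_const_mul, integral_sub hic hs, integral_finsetSum _ hi, Finset.sum_congr rfl hiv]
  rw [e]
  refine (((hasSum_nat_add_iff' m).2 (hcos t)).mul_left _).congr_fun ?_
  intro j
  have h : ((-1 : ℝ) ^ m) * (-1) ^ m = 1 := by rw [← mul_pow]; simp
  rw [pow_add (-1 : ℝ) j m, mul_add 2 j m, pow_add t]
  linear_combination (-((-1) ^ j * (b (j + m) * t ^ (2 * j)) * t ^ (2 * m))) * h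

/-- The rescaled remainders are nonnegative and tend to Y^{2m}/(2m)!, while their integrals tend to
b m. Fatou gives integrability, and dominated convergence then identifies the moment. -/
theorem integral_even_pow [IsProbabilityMeasure μ] (hY : Measurable Y) (hb : Summable fun m => |b m|)
    (hcos : ∀ t : ℝ, HasSum (fun m => (-1) ^ m * (b m * t ^ (2 * m))) (∫ u, Real.cos (t * Y u) ∂μ))
    (m : ℕ) : Integrable (fun u => Y u ^ (2 * m)) μ ∧
      ∫ u, Y u ^ (2 * m) ∂μ = (2 * m).factorial * b m := by
  induction m using Nat.strong_induction_on with
  | _ m ih =>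
  rcases m with _ | m
  -- Order zero is read off at t = 0; the Fatou argument needs a nonnegative remainder, hence m ≥ 1.
  · refine ⟨by simp, ?_⟩
    have h := (hcos 0).unique (hasSum_single 0 fun k hk => by simp [hk])
    simpa using h
  set M := m + 1 with hM
  set t : ℕ → ℝ := fun n => 1 / ((n : ℝ) + 1) with ht_def
  have ht : Filter.Tendsto t Filter.atTop (nhds 0) := tendsto_one_div_add_atTop_nhds_zero_nat
  have ht0 : ∀ n, t n ≠ 0 := fun n => by simp only [ht_def]; positivity
  have ht1 : ∀ n, |t n| ≤ 1 := fun n => by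
    simp only [ht_def]
    rw [abs_of_nonneg (by positivity), div_le_one (by positivity)]
    linarith [(Nat.cast_nonneg n : (0 : ℝ) ≤ n)]
  have htp : ∀ n, 0 < t n ^ (2 * M) := fun n => by rw [pow_mul]; have := ht0 n; positivity
  have hlim := fun u => tendsto_cosRem_div ht ht0 M (Y u)
  have hI := fun n => integral_cosRem_mul hY hcos M ih (t n)
  have hval : ∀ n, ∫ u, cosRem M (t n * Y u) / t n ^ (2 * M) ∂μ =
      ∑' j, (-1) ^ j * (b (j + M) * t n ^ (2 * j)) := by
    intro n
    rw [integral_div, ← (hI n).2.tsum_eq, tsum_mul_right, mul_div_cancel_right₀ _ (htp n).ne']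
  have hG : Filter.Tendsto (fun n => ∫ u, cosRem M (t n * Y u) / t n ^ (2 * M) ∂μ) Filter.atTop
      (nhds (b M)) := by
    simp_rw [hval]
    have h : Filter.Tendsto (fun n => ∑' j, (-1) ^ j * (b (j + M) * t n ^ (2 * j))) Filter.atTop
        (nhds (∑' j, (-1) ^ j * (b (j + M) * 0 ^ (2 * j)))) := by
      refine tendsto_tsum_of_dominated_convergence (bound := fun j => |b (j + M)|)
        ((summable_nat_add_iff M).2 hb) (fun j => ((ht.pow _).const_mul _).const_mul _)
        (Filter.Eventually.of_forall fun n j => ?_)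
      rw [norm_mul, norm_pow, norm_neg, norm_one, one_pow, one_mul, norm_mul, norm_pow,
        Real.norm_eq_abs, Real.norm_eq_abs]
      exact mul_le_of_le_one_right (abs_nonneg _) (pow_le_one₀ (abs_nonneg _) (ht1 n))
    rw [tsum_eq_single 0 (fun j hj => by simp [hj])] at h
    simpa using h
  have hint : Integrable (fun u => Y u ^ (2 * M) / (2 * M).factorial) μ :=
    integrable_of_tendsto_integral (fun n => (hI n).1.div_const _)
      (fun n u => div_nonneg (cosRem_succ_nonneg m _) (htp n).le) hlim hG
  -- The limit, now known to be integrable, itself dominates the sequence by `cosRem_le`.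
  have hlim2 : Filter.Tendsto (fun n => ∫ u, cosRem M (t n * Y u) / t n ^ (2 * M) ∂μ) Filter.atTop
      (nhds (∫ u, Y u ^ (2 * M) / (2 * M).factorial ∂μ)) := by
    refine tendsto_integral_of_dominated_convergence _
      (fun n => ((hI n).1.div_const _).aestronglyMeasurable) hint
      (fun n => ae_of_all _ fun u => ?_) (ae_of_all _ hlim)
    rw [Real.norm_of_nonneg (div_nonneg (cosRem_succ_nonneg m _) (htp n).le), div_le_iff₀ (htp n)]
    refine (cosRem_le M _).trans (le_of_eq ?_)
    ring
  have hf : ((2 * M).factorial : ℝ) ≠ 0 := by positivity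
  refine ⟨(hint.mul_const ((2 * M).factorial : ℝ)).congr (ae_of_all _ fun u => by
    simp only; field_simp), ?_⟩
  have := tendsto_nhds_unique hlim2 hG
  rw [integral_div, div_eq_iff hf] at this
  rw [this, mul_comm]

/-- The partial sums of cosh(aY) are nonnegative with integrals converging to ∑ b m a^{2m}, and
e^{a|Y|} ≤ 2 cosh(aY). -/
theorem integrable_exp_mul_abs [IsProbabilityMeasure μ] (hY : Measurable Y)
    (hb : ∀ r : ℝ, Summable fun m => |b m| * r ^ (2 * m))
    (hcos : ∀ t : ℝ, HasSum (fun m => (-1) ^ m * (b m * t ^ (2 * m))) (∫ u, Real.cos (t * Y u) ∂μ))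
    (a : ℝ) : Integrable (fun u => Real.exp (a * |Y u|)) μ := by
  have hm := integral_even_pow hY (by simpa using hb 1) hcos
  have hcosh : Integrable (fun u => Real.cosh (a * Y u)) μ := by
    have hn : ∀ m u, 0 ≤ (a * Y u) ^ (2 * m) / (2 * m).factorial := fun m u => by
      rw [pow_mul]; positivity
    have hi : ∀ m, Integrable (fun u => (a * Y u) ^ (2 * m) / (2 * m).factorial) μ := by
      intro m
      simp_rw [mul_pow]
      exact ((hm m).1.const_mul _).div_const _
    have hv : ∀ m, ∫ u, (a * Y u) ^ (2 * m) / (2 * m).factorial ∂μ = b m * a ^ (2 * m) := by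
      intro m
      simp_rw [mul_pow]
      rw [integral_div, integral_const_mul, (hm m).2]
      have : ((2 * m).factorial : ℝ) ≠ 0 := by positivity
      field_simp
    have hs : Summable fun m => b m * a ^ (2 * m) := by
      refine Summable.of_norm_bounded (hb a) fun m => le_of_eq ?_
      rw [norm_mul, Real.norm_eq_abs, Real.norm_of_nonneg (by rw [pow_mul]; positivity)]
    refine integrable_of_tendsto_integral
      (F := fun n u => ∑ m ∈ Finset.range n, (a * Y u) ^ (2 * m) / (2 * m).factorial)
      (fun n => integrable_finsetSum _ fun m _ => hi m)
      (fun n u => Finset.sum_nonneg fun m _ => hn m u)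
      (fun u => (Real.hasSum_cosh (a * Y u)).tendsto_sum_nat) (c := ∑' m, b m * a ^ (2 * m)) ?_
    simp_rw [integral_finsetSum _ fun m _ => hi m, hv]
    exact hs.hasSum.tendsto_sum_nat
  refine (hcosh.const_mul 2).mono' (by fun_prop) (ae_of_all _ fun u => ?_)
  rw [Real.norm_of_nonneg (Real.exp_pos _).le, Real.cosh_eq]
  have h1 := Real.exp_pos (a * Y u)
  have h2 := Real.exp_pos (-(a * Y u))
  rcases abs_choice (Y u) with h | h <;> rw [h]
  · linarith
  · rw [mul_neg]; linarith

end Moments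

/-! ### Uniqueness of measures and functions from moments and characteristic functions -/

section CharacteristicFunctions

variable {Ω : Type*} [mΩ : MeasurableSpace Ω] {μ : Measure Ω}

/-- If all moments of `f μ` against `Y` vanish, then so does its characteristic function. -/
theorem integral_mul_exp_eq_zero_of_moments {f : Ω → ℂ} {Y : Ω → ℝ} (hY : Measurable Y)
    (hf : AEStronglyMeasurable f μ) (hfY : Integrable (fun u => ‖f u‖ * Real.exp |Y u|) μ)
    (h : ∀ n : ℕ, ∫ u, f u * (Y u : ℂ) ^ n ∂μ = 0) :
    ∫ u, f u * Complex.exp (Complex.I * (Y u : ℂ)) ∂μ = 0 := by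
  have hs : HasSum (fun n : ℕ => ∫ u, f u * ((Complex.I * (Y u : ℂ)) ^ n / n.factorial) ∂μ)
      (∫ u, f u * Complex.exp (Complex.I * (Y u : ℂ)) ∂μ) := by
    refine hasSum_integral_of_dominated_convergence
      (bound := fun n u => ‖f u‖ * (|Y u| ^ n / n.factorial)) (fun n => ?_) (fun n => ?_) ?_ ?_ ?_
    · exact hf.mul (Measurable.aestronglyMeasurable (by fun_prop))
    · exact ae_of_all _ fun u => by simp
    · exact ae_of_all _ fun u => (Real.summable_pow_div_factorial _).mul_left _
    · refine hfY.congr (ae_of_all _ fun u => ?_)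
      simp only
      rw [tsum_mul_left, Real.exp_eq_exp_ℝ, NormedSpace.exp_eq_tsum_div]
    · refine ae_of_all _ fun u => ?_
      refine HasSum.mul_left _ ?_
      rw [Complex.exp_eq_exp_ℂ]
      exact NormedSpace.expSeries_div_hasSum_exp _
  refine hs.unique ?_
  have : ∀ n : ℕ, ∫ u, f u * ((Complex.I * (Y u : ℂ)) ^ n / n.factorial) ∂μ = 0 := by
    intro n
    have e : ∀ u, f u * ((Complex.I * (Y u : ℂ)) ^ n / n.factorial) =
      (Complex.I ^ n / n.factorial) * (f u * (Y u : ℂ) ^ n) := fun u => by ring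
    simp_rw [e]
    rw [integral_const_mul, h, mul_zero]
  simp_rw [this]
  exact hasSum_zero

variable {ι : Type*} {Y : ι → Ω → ℝ}

/-- Finite measures are determined by the joint characteristic functions of a generating family of
random variables. -/
theorem measure_eq_of_integral_exp_eq (hgen : mΩ = ⨆ i, MeasurableSpace.comap (Y i) inferInstance)
    {ν : Measure Ω} [IsFiniteMeasure μ] [IsFiniteMeasure ν]
    (h : ∀ (I : Finset ι) (t : ι → ℝ),
      ∫ u, Complex.exp (Complex.I * ((∑ i ∈ I, t i * Y i u : ℝ) : ℂ)) ∂μ =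
        ∫ u, Complex.exp (Complex.I * ((∑ i ∈ I, t i * Y i u : ℝ) : ℂ)) ∂ν) : μ = ν := by
  classical
  have hY : ∀ i, Measurable (Y i) := fun i => by
    rw [measurable_iff_comap_le]
    refine (le_iSup (fun i => MeasurableSpace.comap (Y i) inferInstance) i).trans hgen.ge
  set J : Ω → ι → ℝ := fun u i => Y i u with hJ
  have hJm : Measurable J := measurable_pi_lambda _ hY
  have hr : ∀ I : Finset ι, Measurable fun u => I.restrict (J u) := fun I =>
    measurable_pi_lambda _ fun i => hY i
  have hrm : ∀ I : Finset ι, Measurable (I.restrict : (ι → ℝ) → I → ℝ) := fun I =>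
    measurable_pi_lambda _ fun i => measurable_pi_apply _
  -- The finite-dimensional marginals agree by uniqueness of characteristic functions on a
  -- finite-dimensional space, and they determine the law of `J` as a projective limit.
  have hfin : ∀ I : Finset ι, μ.map (fun u => I.restrict (J u)) =
      ν.map (fun u => I.restrict (J u)) := by
    intro I
    refine Measure.ext_of_charFunDual ?_
    ext L
    rw [charFunDual_apply, charFunDual_apply,
      integral_map (hr I).aemeasurable (Measurable.aestronglyMeasurable (by fun_prop)),
      integral_map (hr I).aemeasurable (Measurable.aestronglyMeasurable (by fun_prop))]
    have e : ∀ u, Complex.exp ((L (I.restrict (J u)) : ℂ) * Complex.I) =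
        Complex.exp (Complex.I * ((∑ i ∈ I, (if hi : i ∈ I then
          L (Pi.single ⟨i, hi⟩ 1) else 0) * Y i u : ℝ) : ℂ)) := by
      intro u
      rw [mul_comm]
      congr 3
      have : I.restrict (J u) = ∑ i : I, Y i u • Pi.single (M := fun _ => ℝ) i 1 := by
        ext j
        simp [hJ, Finset.sum_apply, Pi.single_apply]
      rw [this, map_sum, ← Finset.sum_coe_sort I]
      refine Finset.sum_congr rfl fun i _ => ?_
      simp [mul_comm]
    simp_rw [e]
    exact h I _
  have hmap : μ.map J = ν.map J := by
    have h1 : IsProjectiveLimit (μ.map J) fun I => μ.map (fun u => I.restrict (J u)) := fun I => by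
      rw [Measure.map_map (hrm I) hJm]; rfl
    have h2 : IsProjectiveLimit (ν.map J) fun I => μ.map (fun u => I.restrict (J u)) := fun I => by
      rw [Measure.map_map (hrm I) hJm]; exact (hfin I).symm
    exact h1.unique h2
  -- Equality of the laws of `J` gives equality of the measures because every measurable set is a
  -- preimage under `J`.
  have hcomap : mΩ = MeasurableSpace.comap J MeasurableSpace.pi := by
    rw [MeasurableSpace.pi, MeasurableSpace.comap_iSup, hgen]
    simp_rw [MeasurableSpace.comap_comp]
    rfl
  ext A hA
  rw [hcomap] at hA
  obtain ⟨B, hB, rfl⟩ := hA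
  rw [← Measure.map_apply hJm hB, hmap, Measure.map_apply hJm hB]

/-- The positive and negative parts of g are densities of two finite measures with the same
characteristic functions, hence of the same measure. -/
theorem ae_eq_zero_of_integral_exp_real
    (hgen : mΩ = ⨆ i, MeasurableSpace.comap (Y i) inferInstance) {g : Ω → ℝ} (hg : Integrable g μ)
    (h : ∀ (I : Finset ι) (t : ι → ℝ),
      ∫ u, Complex.exp (Complex.I * ((∑ i ∈ I, t i * Y i u : ℝ) : ℂ)) * (g u : ℂ) ∂μ = 0) :
    g =ᵐ[μ] 0 := by
  have hY : ∀ i, Measurable (Y i) := fun i => by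
    rw [measurable_iff_comap_le]
    refine (le_iSup (fun i => MeasurableSpace.comap (Y i) inferInstance) i).trans hgen.ge
  have hgp := hg.real_toNNReal
  have hgn := hg.neg.real_toNNReal
  have hmp : AEMeasurable (fun u => (g u).toNNReal) μ := hg.aemeasurable.real_toNNReal
  have hmn : AEMeasurable (fun u => (-g u).toNNReal) μ := hg.neg.aemeasurable.real_toNNReal
  have hfp : IsFiniteMeasure (μ.withDensity fun u => ((g u).toNNReal : ENNReal)) :=
    isFiniteMeasure_withDensity_ofReal hg.2
  have hfn : IsFiniteMeasure (μ.withDensity fun u => ((-g u).toNNReal : ENNReal)) :=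
    isFiniteMeasure_withDensity_ofReal hg.neg.2
  have key : (μ.withDensity fun u => ((g u).toNNReal : ENNReal)) =
      μ.withDensity fun u => ((-g u).toNNReal : ENNReal) := by
    refine measure_eq_of_integral_exp_eq hgen fun I t => ?_
    rw [integral_withDensity_eq_integral_smul₀ hmp, integral_withDensity_eq_integral_smul₀ hmn,
      ← sub_eq_zero]
    have hE : AEStronglyMeasurable (fun u =>
        Complex.exp (Complex.I * ((∑ i ∈ I, t i * Y i u : ℝ) : ℂ))) μ :=
      Measurable.aestronglyMeasurable (by fun_prop)
    have hEb : ∀ u, ‖Complex.exp (Complex.I * ((∑ i ∈ I, t i * Y i u : ℝ) : ℂ))‖ ≤ 1 := fun u => by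
      rw [mul_comm, Complex.norm_exp_ofReal_mul_I]
    have hi : ∀ k : Ω → ℝ, Integrable k μ → Integrable (fun u =>
        (k u : ℂ) * Complex.exp (Complex.I * ((∑ i ∈ I, t i * Y i u : ℝ) : ℂ))) μ := fun k hk =>
      hk.ofReal.mul_bdd (c := 1) hE (ae_of_all _ hEb)
    rw [← integral_sub, ← h I t]
    · refine integral_congr_ae (ae_of_all _ fun u => ?_)
      simp only [NNReal.smul_def, Complex.real_smul, ← sub_mul, Real.coe_toNNReal']
      rw [mul_comm, ← Complex.ofReal_sub]
      congr 2
      rcases le_total 0 (g u) with h | h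
      · rw [max_eq_left h, max_eq_right (by linarith), sub_zero]
      · rw [max_eq_right h, max_eq_left (by linarith)]; ring
    · exact hi _ hgp
    · exact hi _ hgn
  refine hg.ae_eq_zero_of_forall_setIntegral_eq_zero fun A hA _ => ?_
  rw [integral_eq_lintegral_pos_part_sub_lintegral_neg_part hg.integrableOn, sub_eq_zero]
  have := congrArg (fun m : Measure Ω => (m A).toReal) key
  simp only [withDensity_apply _ hA] at this
  exact this

/-- An integrable function is determined by the integrals of the exponentials of a generating
family of random variables against it. -/
theorem ae_eq_zero_of_integral_exp
    (hgen : mΩ = ⨆ i, MeasurableSpace.comap (Y i) inferInstance) {f : Ω → ℂ} (hf : Integrable f μ)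
    (h : ∀ (I : Finset ι) (t : ι → ℝ),
      ∫ u, Complex.exp (Complex.I * ((∑ i ∈ I, t i * Y i u : ℝ) : ℂ)) * f u ∂μ = 0) :
    f =ᵐ[μ] 0 := by
  have hY : ∀ i, Measurable (Y i) := fun i => by
    rw [measurable_iff_comap_le]
    refine (le_iSup (fun i => MeasurableSpace.comap (Y i) inferInstance) i).trans hgen.ge
  -- Conjugating the hypothesis at -t gives the same vanishing for the conjugate of f, so real and
  -- imaginary parts can be treated separately.
  have hc : ∀ (I : Finset ι) (t : ι → ℝ), ∫ u,
      Complex.exp (Complex.I * ((∑ i ∈ I, t i * Y i u : ℝ) : ℂ)) * (starRingEnd ℂ) (f u) ∂μ = 0 := by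
    intro I t
    have h1 := congrArg (starRingEnd ℂ) (h I (-t))
    rw [map_zero, ← integral_conj] at h1
    rw [← h1]
    refine integral_congr_ae (ae_of_all _ fun u => ?_)
    simp [← Complex.exp_conj]
  have hi : ∀ (I : Finset ι) (t : ι → ℝ) (k : Ω → ℂ), Integrable k μ → Integrable (fun u =>
        Complex.exp (Complex.I * ((∑ i ∈ I, t i * Y i u : ℝ) : ℂ)) * k u) μ := by
    intro I t k hk
    refine hk.bdd_mul (c := 1) (Measurable.aestronglyMeasurable (by fun_prop))
      (ae_of_all _ fun u => ?_)
    rw [mul_comm, Complex.norm_exp_ofReal_mul_I]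
  have hfc : Integrable (fun u => (starRingEnd ℂ) (f u)) μ :=
    (LinearIsometryEquiv.integrable_comp_iff Complex.conjLIE).2 hf
  have hre : (fun u => (f u).re) =ᵐ[μ] 0 := by
    refine ae_eq_zero_of_integral_exp_real hgen hf.re fun I t => ?_
    have e : ∀ u, Complex.exp (Complex.I * ((∑ i ∈ I, t i * Y i u : ℝ) : ℂ)) * ((f u).re : ℂ) =
      2⁻¹ * (Complex.exp (Complex.I * ((∑ i ∈ I, t i * Y i u : ℝ) : ℂ)) * f u +
      Complex.exp (Complex.I * ((∑ i ∈ I, t i * Y i u : ℝ) : ℂ)) * (starRingEnd ℂ) (f u)) := by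
      intro u
      rw [Complex.re_eq_add_conj]
      ring
    simp_rw [e]
    rw [integral_const_mul, integral_add (hi I t _ hf) (hi I t _ hfc), h, hc]
    simp
  have him : (fun u => (f u).im) =ᵐ[μ] 0 := by
    refine ae_eq_zero_of_integral_exp_real hgen hf.im fun I t => ?_
    have e : ∀ u, Complex.exp (Complex.I * ((∑ i ∈ I, t i * Y i u : ℝ) : ℂ)) * ((f u).im : ℂ) =
      (2 * Complex.I)⁻¹ * (Complex.exp (Complex.I * ((∑ i ∈ I, t i * Y i u : ℝ) : ℂ)) * f u -
      Complex.exp (Complex.I * ((∑ i ∈ I, t i * Y i u : ℝ) : ℂ)) * (starRingEnd ℂ) (f u)) := by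
      intro u
      rw [Complex.im_eq_sub_conj]
      ring
    simp_rw [e]
    rw [integral_const_mul, integral_sub (hi I t _ hf) (hi I t _ hfc), h, hc]
    simp
  filter_upwards [hre, him] with u h1 h2
  exact Complex.ext h1 h2

end CharacteristicFunctions

/-! ### Hermite functions -/

theorem polyGauss_apply (p : ℝ[X]) (x : ℝ) :
    polyGauss p x = p.eval x * Real.exp (-(x ^ 2 / 2)) := rfl

theorem polyGauss_add (p q : ℝ[X]) : polyGauss (p + q) = polyGauss p + polyGauss q := by
  ext x
  simp [polyGauss_apply, add_mul]

theorem polyGauss_smul (a : ℝ) (p : ℝ[X]) : polyGauss (a • p) = a • polyGauss p := by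
  ext x
  simp [polyGauss_apply, mul_assoc]

/-- The linear functional `p ↦ ∫ p(x) e^{-x²/2} dx`. -/
noncomputable def gaussIntegral : ℝ[X] →ₗ[ℝ] ℝ where
  toFun p := ∫ x, polyGauss p x
  map_add' p q := by
    simp_rw [polyGauss_add, add_apply]
    exact integral_add (polyGauss p).integrable (polyGauss q).integrable
  map_smul' a p := by
    simp_rw [polyGauss_smul, smul_apply, smul_eq_mul]
    exact integral_const_mul _ _

/-- Integration by parts: the derivative of p e^{-x²/2} has integral zero. With the Hermite
recursion, multiplication by He_n thus becomes n-fold differentiation under the integral. -/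
theorem gaussIntegral_X_mul (p : ℝ[X]) : gaussIntegral (X * p) = gaussIntegral (derivative p) := by
  rw [eq_comm, ← sub_eq_zero, ← map_sub]
  refine integral_eq_zero_of_hasDerivAt_of_integrable (f := polyGauss p) (fun x => ?_)
    (polyGauss _).integrable (polyGauss p).integrable
  have h1 : HasDerivAt (fun x : ℝ => -(x ^ 2 / 2)) (-x) x :=
    ((hasDerivAt_pow 2 x).div_const 2).neg.congr_deriv (by norm_num)
  have h3 := (p.hasDerivAt x).mul h1.exp
  refine HasDerivAt.congr_deriv (f' := _) h3 ?_
  rw [polyGauss_apply]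
  simp
  ring

theorem gaussIntegral_mul_hermite (n : ℕ) (p : ℝ[X]) :
    gaussIntegral (p * (hermite n).map (Int.castRingHom ℝ)) =
      gaussIntegral (derivative^[n] p) := by
  induction n generalizing p with
  | zero => simp
  | succ n ih =>
    rw [Function.iterate_succ_apply, ← ih, hermite_succ, Polynomial.map_sub, Polynomial.map_mul,
      map_X, ← derivative_map, mul_sub, map_sub, mul_left_comm, gaussIntegral_X_mul, derivative_mul,
      map_add, add_sub_cancel_right]

theorem gaussIntegral_one : gaussIntegral 1 = Real.sqrt (2 * Real.pi) := by
  have h := integral_gaussian (1 / 2)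
  rw [show Real.pi / (1 / 2) = 2 * Real.pi by ring] at h
  rw [← h]
  refine integral_congr_ae (ae_of_all _ fun x => ?_)
  simp only [polyGauss_apply, eval_one, one_mul]
  congr 1
  ring

theorem gaussIntegral_hermite_mul_hermite (m n : ℕ) :
    gaussIntegral ((hermite m).map (Int.castRingHom ℝ) * (hermite n).map (Int.castRingHom ℝ)) =
      if m = n then n.factorial * Real.sqrt (2 * Real.pi) else 0 := by
  wlog hmn : m ≤ n generalizing m n
  · rw [mul_comm, this n m (by omega)]
    simp only [eq_comm]
    split_ifs with h
    · rw [h]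
    · rfl
  rw [gaussIntegral_mul_hermite]
  have hd : ((hermite m).map (Int.castRingHom ℝ)).natDegree = m := by
    rw [(hermite_monic m).natDegree_map, natDegree_hermite]
  rcases hmn.lt_or_eq with h | rfl
  · rw [if_neg h.ne, iterate_derivative_eq_zero (by omega), map_zero]
  · rw [if_pos rfl]
    have h1 : derivative^[m] ((hermite m).map (Int.castRingHom ℝ)) = (m.factorial : ℝ) • 1 := by
      rw [eq_C_of_natDegree_le_zero (p := derivative^[m] _)
        ((natDegree_iterate_derivative _ _).trans (by omega)), coeff_iterate_derivative,
        smul_eq_C_mul, mul_one]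
      simp [Nat.descFactorial_self]
    rw [h1, map_smul, gaussIntegral_one, smul_eq_mul]

/-- The embedding of the Schwartz space into `L²(ℝ, dx)`. -/
noncomputable abbrev schwartzToL2 : 𝓢(ℝ, ℝ) →L[ℝ] Lp ℝ 2 (volume : Measure ℝ) :=
  SchwartzMap.toLpCLM ℝ ℝ 2 volume

theorem inner_schwartzToL2 (s t : 𝓢(ℝ, ℝ)) :
    inner ℝ (schwartzToL2 s) (schwartzToL2 t) = ∫ x, s x * t x := by
  rw [L2.inner_def]
  refine integral_congr_ae ?_
  filter_upwards [s.coeFn_toLp 2 volume, t.coeFn_toLp 2 volume] with x h1 h2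
  simp only [SchwartzMap.toLpCLM_apply, h1, h2]
  simp [mul_comm]

theorem normSqL2_eq (s : 𝓢(ℝ, ℝ)) : normSqL2 s = ‖schwartzToL2 s‖ ^ 2 := by
  rw [← real_inner_self_eq_norm_sq, inner_schwartzToL2, normSqL2]
  simp_rw [pow_two]

/-- The product of two Hermite functions carries e^{-x²}; substituting y = √2 x turns this into the
weight e^{-y²/2} of `gaussIntegral`. -/
theorem orthonormal_hermiteFun : Orthonormal ℝ fun n => schwartzToL2 (hermiteFun n) := by
  rw [orthonormal_iff_ite]
  intro m n
  rw [inner_schwartzToL2]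
  have h2 : (0 : ℝ) < Real.sqrt 2 := by positivity
  have e : ∀ x, hermiteFun m x * hermiteFun n x =
      (Real.sqrt (m.factorial * Real.sqrt Real.pi))⁻¹ *
      (Real.sqrt (n.factorial * Real.sqrt Real.pi))⁻¹ *
      polyGauss ((hermite m).map (Int.castRingHom ℝ) * (hermite n).map (Int.castRingHom ℝ))
        (Real.sqrt 2 * x) := by
    intro x
    rw [hermiteFun_apply, hermiteFun_apply, polyGauss_apply, eval_mul, mul_pow,
      Real.sq_sqrt zero_le_two, show -(2 * x ^ 2 / 2) = -(x ^ 2 / 2) + -(x ^ 2 / 2) by ring,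
      Real.exp_add]
    simp only [aeval_def, eval₂_eq_eval_map, algebraMap_int_eq]
    ring
  simp_rw [e]
  rw [integral_const_mul, Measure.integral_comp_mul_left (fun y => polyGauss _ y) (Real.sqrt 2)]
  have h := gaussIntegral_hermite_mul_hermite m n
  change ∫ x, _ = _ at h
  rw [h]
  split_ifs with hmn
  · subst hmn
    have hf : (0 : ℝ) < m.factorial := by positivity
    have hp : 0 < Real.sqrt Real.pi := by positivity
    rw [abs_of_pos (by positivity), ← mul_inv, Real.mul_self_sqrt (by positivity),
      Real.sqrt_mul zero_le_two, smul_eq_mul]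
    field_simp
  · simp

/-- The Hermite polynomials `He_n(√2 x)`, as a sequence with the degree equal to the index. -/
noncomputable def scaledHermite : Polynomial.Sequence ℝ where
  elems' n := ((hermite n).map (Int.castRingHom ℝ)).comp (C (Real.sqrt 2) * X)
  degree_eq' n := by
    have h2 : Real.sqrt 2 ≠ 0 := by positivity
    have hne : ((hermite n).map (Int.castRingHom ℝ)) ≠ 0 := ((hermite_monic n).map _).ne_zero
    have hnd : (((hermite n).map (Int.castRingHom ℝ)).comp (C (Real.sqrt 2) * X)).natDegree = n := by
      rw [natDegree_comp, natDegree_C_mul_X _ h2, (hermite_monic n).natDegree_map,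
        natDegree_hermite, mul_one]
    have hne' : ((hermite n).map (Int.castRingHom ℝ)).comp (C (Real.sqrt 2) * X) ≠ 0 := by
      intro h
      rcases comp_eq_zero_iff.1 h with h | h
      · exact hne h
      · have := congrArg natDegree h.2
        rw [natDegree_C_mul_X _ h2, natDegree_C] at this
        exact one_ne_zero this
    rw [degree_eq_natDegree hne', hnd]

theorem polyGauss_mem_span (p : ℝ[X]) :
    polyGauss p ∈ Submodule.span ℝ (Set.range hermiteFun) := by
  have hp : p ∈ Submodule.span ℝ (Set.range scaledHermite) := by
    rw [Polynomial.Sequence.span _ fun i =>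
      (leadingCoeff_ne_zero.2 (scaledHermite.ne_zero i)).isUnit]
    trivial
  induction hp using Submodule.span_induction with
  | mem p hp =>
    obtain ⟨n, rfl⟩ := hp
    have hc : Real.sqrt (n.factorial * Real.sqrt Real.pi) ≠ 0 := by positivity
    have : polyGauss (scaledHermite n) =
        Real.sqrt (n.factorial * Real.sqrt Real.pi) • hermiteFun n := by
      rw [hermiteFun, smul_smul, mul_inv_cancel₀ hc, one_smul]
      rfl
    rw [this]
    exact Submodule.smul_mem _ _ (Submodule.subset_span ⟨n, rfl⟩)
  | zero =>
    have : polyGauss 0 = 0 := by ext x; simp [polyGauss_apply]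
    rw [this]
    exact Submodule.zero_mem _
  | add p q _ _ hp hq => rw [polyGauss_add]; exact Submodule.add_mem _ hp hq
  | smul a p _ hp => rw [polyGauss_smul]; exact Submodule.smul_mem _ _ hp

theorem memLp_exp_mul_gauss (t : ℝ) :
    MemLp (fun x : ℝ => Real.exp (-(x ^ 2 / 2)) * Real.exp |t * x|) 2 := by
  rw [memLp_two_iff_integrable_sq (Continuous.aestronglyMeasurable (by fun_prop))]
  -- The constant comes from completing the square: -x² + 2|t||x| ≤ 2t² - x²/2.
  refine ((integrable_exp_neg_mul_sq (b := 1 / 2) (by norm_num)).const_mul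
    (Real.exp (2 * t ^ 2))).mono' (Continuous.aestronglyMeasurable (by fun_prop))
    (ae_of_all _ fun x => ?_)
  rw [Real.norm_of_nonneg (by positivity), ← Real.exp_add, ← Real.exp_nat_mul, ← Real.exp_add]
  refine Real.exp_le_exp.2 ?_
  rw [abs_mul]
  push_cast
  nlinarith [sq_nonneg (|x| - 2 * |t|), sq_abs x, sq_abs t]

/-- If g is orthogonal to the span, all moments of g e^{-x²/2} vanish. This function has exponential
moments, so its Fourier transform vanishes, and the Gaussian factor is never zero. -/
theorem topologicalClosure_span_hermiteFun :
    (Submodule.span ℝ (Set.range fun n => schwartzToL2 (hermiteFun n))).topologicalClosure = ⊤ := by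
  rw [Submodule.topologicalClosure_eq_top_iff, Submodule.eq_bot_iff]
  intro g hg
  have hpoly : ∀ p : ℝ[X], ∫ x, polyGauss p x * g x = 0 := by
    intro p
    have hp : schwartzToL2 (polyGauss p) ∈
        Submodule.span ℝ (Set.range fun n => schwartzToL2 (hermiteFun n)) := by
      have := Submodule.mem_map_of_mem (f := schwartzToL2.toLinearMap)
        (polyGauss_mem_span p)
      rwa [Submodule.map_span, ← Set.range_comp] at this
    rw [← (Submodule.mem_orthogonal _ _).1 hg _ hp, L2.inner_def]
    refine integral_congr_ae ?_
    filter_upwards [(polyGauss p).coeFn_toLp 2 volume] with x h1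
    simp only [SchwartzMap.toLpCLM_apply, h1]
    simp [mul_comm]
  have hgi : ∀ t : ℝ, Integrable fun x => g x * (Real.exp (-(x ^ 2 / 2)) * Real.exp |t * x|) :=
    fun t => (Lp.memLp g).integrable_mul (memLp_exp_mul_gauss t)
  have hgm := (Lp.memLp g).1
  have hz : (fun x => g x * Real.exp (-(x ^ 2 / 2))) =ᵐ[volume] 0 := by
    refine ae_eq_zero_of_integral_exp_real (ι := Unit) (Y := fun _ x => x) ?_
      (by simpa using hgi 0) fun I t => ?_
    · rw [iSup_const]
      exact MeasurableSpace.comap_id.symm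
    simp_rw [← Finset.sum_mul, mul_comm (Complex.exp _)]
    refine integral_mul_exp_eq_zero_of_moments (by fun_prop) ?_ ?_ fun n => ?_
    · exact Complex.continuous_ofReal.comp_aestronglyMeasurable
        (hgm.mul (Continuous.aestronglyMeasurable (by fun_prop)))
    · refine (hgi (∑ i ∈ I, t i)).norm.congr (ae_of_all _ fun x => ?_)
      simp only [Complex.norm_real, norm_mul, Real.norm_of_nonneg (Real.exp_pos _).le, mul_assoc]
    · have e : ∀ x : ℝ, ((g x * Real.exp (-(x ^ 2 / 2)) : ℝ) : ℂ) *
          (((∑ i ∈ I, t i) * x : ℝ) : ℂ) ^ n =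
          (((∑ i ∈ I, t i) ^ n * (polyGauss (X ^ n) x * g x) : ℝ) : ℂ) := by
        intro x
        rw [polyGauss_apply]
        push_cast
        simp
        ring
      simp_rw [e]
      rw [integral_complex_ofReal, integral_const_mul, hpoly, mul_zero, Complex.ofReal_zero]
  rw [Lp.eq_zero_iff_ae_eq_zero]
  filter_upwards [hz] with x hx
  simpa [Real.exp_ne_zero] using hx

/-! ### The coordinate random variables -/

theorem measurable_Q (s : 𝓢(ℝ, ℝ)) : Measurable (Q s) := by
  rw [measurable_iff_comap_le]
  exact le_iSup (fun s : 𝓢(ℝ, ℝ) => MeasurableSpace.comap (Q s) inferInstance) s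

theorem Q_smul (a : ℝ) (s : 𝓢(ℝ, ℝ)) (T : RealDistribution) : Q (a • s) T = a * Q s T :=
  ContinuousLinearMap.map_smul (M₂ := ℝ) T a s

theorem Q_add (s t : 𝓢(ℝ, ℝ)) (T : RealDistribution) : Q (s + t) T = Q s T + Q t T :=
  ContinuousLinearMap.map_add (M₂ := ℝ) T s t

theorem Q_zero (T : RealDistribution) : Q 0 T = 0 :=
  ContinuousLinearMap.map_zero (M₂ := ℝ) T

theorem Q_sub (s t : 𝓢(ℝ, ℝ)) (T : RealDistribution) : Q (s - t) T = Q s T - Q t T := by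
  rw [eq_sub_iff_add_eq, ← Q_add, sub_add_cancel]

theorem Q_sum {ι : Type*} (I : Finset ι) (t : ι → ℝ) (s : ι → 𝓢(ℝ, ℝ)) (T : RealDistribution) :
    Q (∑ i ∈ I, t i • s i) T = ∑ i ∈ I, t i * Q (s i) T := by
  classical
  induction I using Finset.induction_on with
  | empty => simp [Q_zero]
  | insert i I hi ih => rw [Finset.sum_insert hi, Finset.sum_insert hi, Q_add, Q_smul, ih]

theorem charFunctional_eq_of_norm (φ : ℂ → ℂ) (s : 𝓢(ℝ, ℝ)) :
    charFunctional φ s = φ ((-(‖schwartzToL2 s‖ ^ 2) / 2 : ℝ) : ℂ) := by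
  rw [charFunctional, normSqL2_eq]

variable {φ : ℂ → ℂ} {P : Measure RealDistribution}

/-- The Taylor coefficients of `t ↦ E cos (t Q_s)`. -/
noncomputable def cosCoeff (φ : ℂ → ℂ) (s : 𝓢(ℝ, ℝ)) (m : ℕ) : ℝ :=
  ((m.factorial : ℂ)⁻¹ * iteratedDeriv m φ 0).re * (‖schwartzToL2 s‖ ^ 2 / 2) ^ m

theorem summable_cosCoeff (hφ : IsML φ) (s : 𝓢(ℝ, ℝ)) (r : ℝ) :
    Summable fun m => |cosCoeff φ s m| * r ^ (2 * m) := by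
  have h := (Complex.hasSum_taylorSeries_of_entire hφ.entire 0
    ((‖schwartzToL2 s‖ ^ 2 / 2 * r ^ 2 : ℝ) : ℂ)).summable.norm
  refine Summable.of_nonneg_of_le (fun m => ?_) (fun m => ?_) h
  · rw [pow_mul]; positivity
  · rw [cosCoeff, sub_zero, smul_smul, norm_smul, norm_mul, norm_pow, Complex.norm_real,
      Real.norm_of_nonneg (by positivity), mul_pow, ← pow_mul, abs_mul,
      abs_of_nonneg (by positivity : 0 ≤ (‖schwartzToL2 s‖ ^ 2 / 2) ^ m)]
    have h1 := Complex.abs_re_le_norm ((m.factorial : ℂ)⁻¹ * iteratedDeriv m φ 0)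
    rw [norm_mul] at h1
    have h2 : 0 ≤ (‖schwartzToL2 s‖ ^ 2 / 2) ^ m * r ^ (2 * m) := by rw [pow_mul r]; positivity
    calc _ = |((m.factorial : ℂ)⁻¹ * iteratedDeriv m φ 0).re| *
          ((‖schwartzToL2 s‖ ^ 2 / 2) ^ m * r ^ (2 * m)) := by ring
      _ ≤ _ := mul_le_mul_of_nonneg_right h1 h2
      _ = _ := by ring

/-- Real part of the Taylor series of φ at the point -t²‖s‖²/2. -/
theorem hasSum_cosCoeff (hφ : IsML φ) (hP : IsPφ φ P) (s : 𝓢(ℝ, ℝ)) (t : ℝ) :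
    HasSum (fun m => (-1) ^ m * (cosCoeff φ s m * t ^ (2 * m)))
      (∫ T, Real.cos (t * Q s T) ∂P) := by
  have := hP.isProbabilityMeasure
  have hm := measurable_Q s
  have h := Complex.hasSum_re (Complex.hasSum_taylorSeries_of_entire hφ.entire 0
    ((-(‖schwartzToL2 (t • s)‖ ^ 2) / 2 : ℝ) : ℂ))
  rw [← charFunctional_eq_of_norm φ, hP.charFunctional_eq] at h
  have e : (∫ T, Complex.exp (Complex.I * (Q (t • s) T : ℂ)) ∂P).re =
      ∫ T, Real.cos (t * Q s T) ∂P := by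
    have hi : Integrable (fun T => Complex.exp (Complex.I * (Q (t • s) T : ℂ))) P := by
      have hm' := measurable_Q (t • s)
      refine Integrable.of_bound (Measurable.aestronglyMeasurable (by fun_prop)) 1
        (ae_of_all _ fun T => ?_)
      rw [mul_comm, Complex.norm_exp_ofReal_mul_I]
    have h1 := integral_re hi
    simp only [RCLike.re_eq_complex_re] at h1
    rw [← h1]
    refine integral_congr_ae (ae_of_all _ fun T => ?_)
    simp only
    rw [mul_comm, Complex.exp_ofReal_mul_I_re, Q_smul]
  rw [e] at h
  refine h.congr_fun fun m => ?_
  rw [cosCoeff, map_smul, norm_smul, sub_zero, smul_eq_mul, smul_eq_mul,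
    show (-((‖t‖ * ‖schwartzToL2 s‖) ^ 2) / 2 : ℝ) = (-1) * (‖schwartzToL2 s‖ ^ 2 / 2 * t ^ 2) by
      rw [mul_pow, Real.norm_eq_abs, sq_abs]; ring, mul_left_comm (m.factorial : ℂ)⁻¹,
    ← Complex.ofReal_pow, Complex.re_ofReal_mul, mul_pow, mul_pow, ← pow_mul]
  ring

theorem integrable_exp_abs_Q (hφ : IsML φ) (hP : IsPφ φ P) (s : 𝓢(ℝ, ℝ)) (a : ℝ) :
    Integrable (fun T => Real.exp (a * |Q s T|)) P :=
  have := hP.isProbabilityMeasure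
  integrable_exp_mul_abs (measurable_Q s) (summable_cosCoeff hφ s) (hasSum_cosCoeff hφ hP s) a

theorem integral_Q_sq (hφ : IsML φ) (hP : IsPφ φ P) (s : 𝓢(ℝ, ℝ)) :
    ∫ T, Q s T ^ 2 ∂P = (deriv φ 0).re * ‖schwartzToL2 s‖ ^ 2 := by
  have := hP.isProbabilityMeasure
  have h := (integral_even_pow (measurable_Q s) (by simpa using summable_cosCoeff hφ s 1)
    (hasSum_cosCoeff hφ hP s) 1).2
  simp only [mul_one] at h
  rw [h, cosCoeff]
  simp [iteratedDeriv_one]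
  ring

/-- This is where φ'(0) > 0 enters: it is the variance of Q_s for a unit vector s. -/
theorem not_ae_Q_eq_zero (hφ : IsML φ) (hP : IsPφ φ P) {s : 𝓢(ℝ, ℝ)}
    (hs : ‖schwartzToL2 s‖ = 1) : ¬ ∀ᵐ T ∂P, Q s T = 0 := by
  intro h
  obtain ⟨r, hr, hr'⟩ := hφ.deriv_zero
  have h1 := integral_Q_sq hφ hP s
  rw [hs, hr', integral_eq_zero_of_ae (by filter_upwards [h] with T hT; simp [hT])] at h1
  simp at h1
  exact hr.ne h1

theorem memLp_Q (hφ : IsML φ) (hP : IsPφ φ P) (s : 𝓢(ℝ, ℝ)) (p : ℕ) :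
    MemLp (fun T => (Q s T : ℂ)) p P := by
  have := hP.isProbabilityMeasure
  have hm := measurable_Q s
  have h2 : MemLp (fun T => (Q s T : ℂ)) ((p + 1 : ℕ) : ENNReal) P := by
    rw [← integrable_norm_rpow_iff (Measurable.aestronglyMeasurable (by fun_prop)) (by simp)
      (by simp)]
    simp_rw [ENNReal.toReal_natCast, Real.rpow_natCast]
    refine ((integrable_exp_abs_Q hφ hP s 1).const_mul ((p + 1).factorial : ℝ)).mono'
      (Measurable.aestronglyMeasurable (by fun_prop)) (ae_of_all _ fun T => ?_)
    have h := Real.pow_div_factorial_le_exp |Q s T| (abs_nonneg _) (p + 1)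
    rw [div_le_iff₀ (by positivity)] at h
    simp
    linarith
  exact h2.mono_exponent (by exact_mod_cast Nat.le_succ p)

/-- Polynomials in the coordinates have moments of all orders. -/
theorem memLp_aeval_Q (hφ : IsML φ) (hP : IsPφ φ P) {σ : Type*} (s : σ → 𝓢(ℝ, ℝ))
    (q : MvPolynomial σ ℂ) (p : ℕ) :
    MemLp (fun T => MvPolynomial.eval (fun j => (Q (s j) T : ℂ)) q) p P := by
  have := hP.isProbabilityMeasure
  induction q using MvPolynomial.induction_on generalizing p with
  | C a => simpa using memLp_const a
  | add q r hq hr =>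
    simp_rw [map_add]
    exact (hq p).add (hr p)
  | mul_X q j hq =>
    -- Hölder with exponents 2p and 2p, for which the induction keeps p arbitrary.
    have h1 := hq (2 * p)
    have h2 := memLp_Q hφ hP (s j) (2 * p)
    have : ENNReal.HolderTriple ((2 * p : ℕ) : ENNReal) ((2 * p : ℕ) : ENNReal) p := by
      constructor
      push_cast
      rw [ENNReal.mul_inv (by simp) (by simp), ← add_mul, ENNReal.inv_two_add_inv_two, one_mul]
    simp_rw [map_mul, MvPolynomial.eval_X]
    exact h2.mul h1 (r := p)

theorem monomialFun_eq_eval (γ : ℕ →₀ ℕ) (T : RealDistribution) : monomialFun γ T =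
    MvPolynomial.eval (fun j => (Q (hermiteFun j) T : ℂ)) (MvPolynomial.monomial γ 1) := by
  rw [MvPolynomial.eval_monomial, one_mul, monomialFun]

theorem memLp_monomialFun (hφ : IsML φ) (hP : IsPφ φ P) (γ : ℕ →₀ ℕ) :
    MemLp (monomialFun γ) 2 P := by
  have h := memLp_aeval_Q hφ hP hermiteFun (MvPolynomial.monomial γ 1) 2
  simp_rw [← monomialFun_eq_eval] at h
  exact h

/-! ### Equality of joint laws -/

/-- The joint law of the coordinates along an orthonormal family depends only on its index set. -/
theorem map_Q_eq_of_orthonormal (hP : IsPφ φ P) {ι : Type*} {s s' : ι → 𝓢(ℝ, ℝ)}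
    (hs : Orthonormal ℝ fun i => schwartzToL2 (s i))
    (hs' : Orthonormal ℝ fun i => schwartzToL2 (s' i)) :
    P.map (fun T i => Q (s i) T) = P.map (fun T i => Q (s' i) T) := by
  have := hP.isProbabilityMeasure
  have hm : ∀ s : ι → 𝓢(ℝ, ℝ), Measurable fun T i => Q (s i) T := fun s =>
    measurable_pi_lambda _ fun i => measurable_Q _
  have := Measure.isProbabilityMeasure_map (hm s).aemeasurable (μ := P)
  have := Measure.isProbabilityMeasure_map (hm s').aemeasurable (μ := P)
  refine measure_eq_of_integral_exp_eq (Y := fun (i : ι) (x : ι → ℝ) => x i) rfl fun I t => ?_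
  have key : ∀ s : ι → 𝓢(ℝ, ℝ), Orthonormal ℝ (fun i => schwartzToL2 (s i)) →
      ∫ x, Complex.exp (Complex.I * ((∑ i ∈ I, t i * x i : ℝ) : ℂ)) ∂(P.map fun T i => Q (s i) T) =
        φ ((-(∑ i ∈ I, t i ^ 2) / 2 : ℝ) : ℂ) := by
    intro s hs
    rw [integral_map (hm s).aemeasurable (Measurable.aestronglyMeasurable (by fun_prop))]
    simp_rw [← Q_sum]
    rw [← hP.charFunctional_eq, charFunctional_eq_of_norm, map_sum]
    simp_rw [map_smul]
    rw [← real_inner_self_eq_norm_sq, hs.inner_sum]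
    simp [pow_two]
  rw [key s hs, key s' hs']

theorem ae_iff_of_orthonormal (hP : IsPφ φ P) {ι : Type*} {s s' : ι → 𝓢(ℝ, ℝ)}
    (hs : Orthonormal ℝ fun i => schwartzToL2 (s i))
    (hs' : Orthonormal ℝ fun i => schwartzToL2 (s' i)) {p : (ι → ℝ) → Prop}
    (hp : MeasurableSet {x | p x}) (h : ∀ᵐ T ∂P, p fun i => Q (s i) T) :
    ∀ᵐ T ∂P, p fun i => Q (s' i) T := by
  have hm : ∀ s : ι → 𝓢(ℝ, ℝ), Measurable fun T i => Q (s i) T := fun s =>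
    measurable_pi_lambda _ fun i => measurable_Q _
  rw [← ae_map_iff (hm _).aemeasurable hp] at h ⊢
  rwa [← map_Q_eq_of_orthonormal hP hs hs']

/-! ### Density of the polynomials -/

/-- The class in `L²` of a polynomial in the coordinates `⟨T, ζ_j⟩`. -/
noncomputable def polyL2 (hφ : IsML φ) (hP : IsPφ φ P) : MvPolynomial ℕ ℂ →ₗ[ℂ] Lp ℂ 2 P where
  toFun q := (memLp_aeval_Q hφ hP hermiteFun q 2).toLp
  map_add' q r := by
    rw [← MemLp.toLp_add]
    refine MemLp.toLp_congr _ _ (ae_of_all _ fun T => ?_)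
    simp
  map_smul' a q := by
    rw [RingHom.id_apply, ← MemLp.toLp_const_smul]
    refine MemLp.toLp_congr _ _ (ae_of_all _ fun T => ?_)
    simp [MvPolynomial.smul_eval]

theorem coeFn_polyL2 (hφ : IsML φ) (hP : IsPφ φ P) (q : MvPolynomial ℕ ℂ) :
    polyL2 hφ hP q =ᵐ[P] fun T => MvPolynomial.eval (fun j => (Q (hermiteFun j) T : ℂ)) q :=
  (memLp_aeval_Q hφ hP hermiteFun q 2).coeFn_toLp

theorem polyL2_monomial (hφ : IsML φ) (hP : IsPφ φ P) (γ : ℕ →₀ ℕ) :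
    polyL2 hφ hP (MvPolynomial.monomial γ 1) = monomialL2 P γ := by
  rw [monomialL2, dif_pos (memLp_monomialFun hφ hP γ)]
  exact MemLp.toLp_congr (memLp_aeval_Q hφ hP hermiteFun _ 2) _
    (ae_of_all _ fun T => (monomialFun_eq_eval γ T).symm)

theorem polyL2_mem_span (hφ : IsML φ) (hP : IsPφ φ P) (q : MvPolynomial ℕ ℂ) :
    polyL2 hφ hP q ∈ Submodule.span ℂ (Set.range (monomialL2 P)) := by
  induction q using MvPolynomial.induction_on' with
  | monomial γ a =>
    have : MvPolynomial.monomial γ a = a • MvPolynomial.monomial γ (1 : ℂ) := by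
      rw [MvPolynomial.smul_monomial, smul_eq_mul, mul_one]
    rw [this, map_smul, polyL2_monomial]
    exact Submodule.smul_mem _ _ (Submodule.subset_span ⟨γ, rfl⟩)
  | add p q hp hq => rw [map_add]; exact Submodule.add_mem _ hp hq

theorem memLp_exp_Q (hP : IsPφ φ P) (s : 𝓢(ℝ, ℝ)) :
    MemLp (fun T => Complex.exp (Complex.I * (Q s T : ℂ))) 2 P := by
  have := hP.isProbabilityMeasure
  have hm := measurable_Q s
  refine MemLp.of_bound (Measurable.aestronglyMeasurable (by fun_prop)) 1 (ae_of_all _ fun T => ?_)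
  rw [mul_comm, Complex.norm_exp_ofReal_mul_I]

/-- The class in `L²` of `e^{i Q_s}`. -/
noncomputable def expL2 (hP : IsPφ φ P) (s : 𝓢(ℝ, ℝ)) : Lp ℂ 2 P := (memLp_exp_Q hP s).toLp

theorem coeFn_expL2 (hP : IsPφ φ P) (s : 𝓢(ℝ, ℝ)) :
    expL2 hP s =ᵐ[P] fun T => Complex.exp (Complex.I * (Q s T : ℂ)) :=
  MemLp.coeFn_toLp _

theorem inner_expL2 (hP : IsPφ φ P) (s t : 𝓢(ℝ, ℝ)) :
    inner ℂ (expL2 hP t) (expL2 hP s) = charFunctional φ (s - t) := by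
  rw [hP.charFunctional_eq, L2.inner_def]
  refine integral_congr_ae ?_
  filter_upwards [coeFn_expL2 hP s, coeFn_expL2 hP t] with T h1 h2
  rw [h1, h2, RCLike.inner_apply, ← Complex.exp_conj, ← Complex.exp_add, Q_sub]
  congr 1
  simp
  ring

/-- Makes s ↦ e^{iQ_s} continuous for the L²(ℝ) norm, since φ is continuous and φ(0) = 1. -/
theorem norm_expL2_sub_sq (hφ : IsML φ) (hP : IsPφ φ P) (s t : 𝓢(ℝ, ℝ)) :
    ‖expL2 hP s - expL2 hP t‖ ^ 2 = 2 - 2 * (charFunctional φ (t - s)).re := by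
  have h1 : ∀ s, ‖expL2 hP s‖ ^ 2 = 1 := by
    intro s
    have h := inner_self_eq_norm_sq (𝕜 := ℂ) (expL2 hP s)
    rw [inner_expL2, sub_self, charFunctional_eq_of_norm, map_zero] at h
    rw [← h]
    simp [hφ.map_zero]
  rw [@norm_sub_sq ℂ, inner_expL2, h1, h1]
  simp only [RCLike.re_eq_complex_re]
  ring

/-- By passing to the double orthogonal complement. For such s the powers of Q_s are polynomials in
the coordinates, so any f orthogonal to the monomials has vanishing moments against Q_s. -/
theorem expL2_mem_of_mem_span (hφ : IsML φ) (hP : IsPφ φ P) {s : 𝓢(ℝ, ℝ)}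
    (hs : s ∈ Submodule.span ℝ (Set.range hermiteFun)) :
    expL2 hP s ∈ (Submodule.span ℂ (Set.range (monomialL2 P))).topologicalClosure := by
  rw [← Submodule.orthogonal_orthogonal_eq_closure, Submodule.mem_orthogonal]
  intro f hf
  obtain ⟨c, rfl⟩ := Finsupp.mem_span_range_iff_exists_finsupp.1 hs
  set s := c.sum fun i a => a • hermiteFun i with hs_def
  set l : MvPolynomial ℕ ℂ := ∑ i ∈ c.support, MvPolynomial.C (c i : ℂ) * MvPolynomial.X i
  have hl : ∀ T, (Q s T : ℂ) = MvPolynomial.eval (fun j => (Q (hermiteFun j) T : ℂ)) l := by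
    intro T
    simp [l, hs_def, Finsupp.sum, Q_sum]
  have hm := measurable_Q s
  have key := integral_mul_exp_eq_zero_of_moments (μ := P) (f := fun T => (starRingEnd ℂ) (f T))
    (Y := Q s) hm (Complex.continuous_conj.comp_aestronglyMeasurable (Lp.memLp f).1) ?_ fun n => ?_
  · rw [← key, L2.inner_def]
    refine integral_congr_ae ?_
    filter_upwards [coeFn_expL2 hP s] with T h1
    rw [h1, RCLike.inner_apply, mul_comm]
  · simp only [RCLike.norm_conj]
    refine (Lp.memLp f).norm.integrable_mul (q := 2) ?_
    rw [memLp_two_iff_integrable_sq (Measurable.aestronglyMeasurable (by fun_prop))]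
    refine (integrable_exp_abs_Q hφ hP s 2).congr (ae_of_all _ fun T => ?_)
    simp only
    rw [← Real.exp_nat_mul]
    norm_num
  · rw [← (Submodule.mem_orthogonal' _ _).1 hf _ (polyL2_mem_span hφ hP (l ^ n)), L2.inner_def]
    refine integral_congr_ae ?_
    filter_upwards [coeFn_polyL2 hφ hP (l ^ n)] with T h1
    rw [h1, RCLike.inner_apply, mul_comm, map_pow, hl]

theorem expL2_mem (hφ : IsML φ) (hP : IsPφ φ P) (s : 𝓢(ℝ, ℝ)) :
    expL2 hP s ∈ (Submodule.span ℂ (Set.range (monomialL2 P))).topologicalClosure := by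
  have hs : schwartzToL2 s ∈ (Submodule.span ℝ
      (Set.range fun n => schwartzToL2 (hermiteFun n))).topologicalClosure := by
    rw [topologicalClosure_span_hermiteFun]
    trivial
  obtain ⟨v, hv, hlim⟩ := mem_closure_iff_seq_limit.1 hs
  have hex : ∀ k, ∃ t ∈ Submodule.span ℝ (Set.range hermiteFun), schwartzToL2 t = v k := by
    intro k
    have h := hv k
    rw [SetLike.mem_coe] at h
    have e : (Set.range fun n => schwartzToL2 (hermiteFun n)) =
        schwartzToL2.toLinearMap '' Set.range hermiteFun := by
      rw [← Set.range_comp]; rfl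
    rw [e, ← Submodule.map_span] at h
    obtain ⟨t, ht, h⟩ := h
    exact ⟨t, ht, h⟩
  choose t ht hvt using hex
  refine IsClosed.mem_of_tendsto (Submodule.isClosed_topologicalClosure _) (b := Filter.atTop)
    (f := fun k => expL2 hP (t k)) ?_
    (Filter.Eventually.of_forall fun k => expL2_mem_of_mem_span hφ hP (ht k))
  rw [tendsto_iff_norm_sub_tendsto_zero]
  have h2 : Filter.Tendsto (fun k => ‖expL2 hP (t k) - expL2 hP s‖ ^ 2) Filter.atTop (nhds 0) := by
    simp_rw [norm_expL2_sub_sq hφ, charFunctional_eq_of_norm, map_sub, hvt]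
    have h3 : Filter.Tendsto (fun k => ‖schwartzToL2 s - v k‖) Filter.atTop (nhds 0) := by
      simpa using (hlim.const_sub (schwartzToL2 s)).norm
    have hc : Continuous fun x : ℝ => 2 - 2 * (φ ((-(x ^ 2) / 2 : ℝ) : ℂ)).re := by
      have := hφ.entire.continuous
      fun_prop
    have h4 := (hc.tendsto 0).comp h3
    have h5 : 2 - 2 * (φ ((-((0 : ℝ) ^ 2) / 2 : ℝ) : ℂ)).re = 0 := by simp [hφ.map_zero]
    rw [h5] at h4
    exact h4
  have h5 := h2.sqrt
  simpa using h5

theorem topologicalClosure_span_monomialL2 (hφ : IsML φ) (hP : IsPφ φ P) :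
    (Submodule.span ℂ (Set.range (monomialL2 P))).topologicalClosure = ⊤ := by
  have := hP.isProbabilityMeasure
  rw [Submodule.topologicalClosure_eq_top_iff, Submodule.eq_bot_iff]
  intro f hf
  rw [← Submodule.orthogonal_closure] at hf
  have h0 : f =ᵐ[P] 0 := by
    refine ae_eq_zero_of_integral_exp (Y := Q) rfl ((Lp.memLp f).integrable one_le_two)
      fun I t => ?_
    -- The inner product conjugates its first argument, hence the sign in `-t i`.
    rw [← (Submodule.mem_orthogonal _ _).1 hf _
      (expL2_mem hφ hP (∑ i ∈ I, (-t i) • i)), L2.inner_def]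
    refine integral_congr_ae ?_
    filter_upwards [coeFn_expL2 hP (∑ i ∈ I, (-t i) • i)] with T h1
    rw [h1, RCLike.inner_apply, ← Complex.exp_conj, mul_comm, Q_sum]
    congr 2
    simp
  exact (Lp.eq_zero_iff_ae_eq_zero).2 h0

/-! ### Algebraic independence of the coordinates -/

theorem exists_rotation_eq (y y' : ℝ) {v : ℝ} (hv : v ∈ Set.Icc (-|y|) |y|) :
    ∃ θ : ℝ, Real.sin θ * y' + Real.cos θ * y = v := by
  have hc : Continuous fun θ : ℝ => Real.sin θ * y' + Real.cos θ * y := by fun_prop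
  have h0 : (fun θ : ℝ => Real.sin θ * y' + Real.cos θ * y) 0 = y := by simp
  have h1 : (fun θ : ℝ => Real.sin θ * y' + Real.cos θ * y) Real.pi = -y := by simp
  refine mem_range_of_exists_le_of_exists_ge hc ?_ ?_
  · rcases abs_choice y with h | h
    · exact ⟨Real.pi, by simp only at h1; rw [h1]; rw [h] at hv; exact hv.1⟩
    · exact ⟨0, by simp only at h0; rw [h0]; rw [h, neg_neg] at hv; exact hv.1⟩
  · rcases abs_choice y with h | h
    · exact ⟨0, by simp only at h0; rw [h0]; rw [h] at hv; exact hv.2⟩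
    · exact ⟨Real.pi, by simp only at h1; rw [h1]; rw [h] at hv; exact hv.2⟩

theorem polynomial_eq_zero_of_Icc {r : ℂ[X]} {y : ℝ} (hy : y ≠ 0)
    (h : ∀ v ∈ Set.Icc (-|y|) |y|, r.eval (v : ℂ) = 0) : r = 0 := by
  refine r.eq_zero_of_infinite_isRoot
    (Set.Infinite.mono ?_ ((Set.Icc_infinite (a := -|y|) (b := |y|) ?_).image
      (f := fun x : ℝ => (x : ℂ)) Complex.ofReal_injective.injOn))
  · rintro _ ⟨v, hv, rfl⟩
    exact h v hv
  · have := abs_pos.2 hy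
    linarith

/-- With v the rotated first value, the other factor has square y² + y'² - v². Hence r(v)(v² - y² -
y'²) vanishes on the interval swept by v, and the quadratic factor is a nonzero polynomial. -/
theorem polynomial_eq_zero_of_rotation {r : ℂ[X]} {y y' : ℝ} (hy : y ≠ 0)
    (h : ∀ θ : ℝ, r.eval ((Real.sin θ * y' + Real.cos θ * y : ℝ) : ℂ) *
      ((Real.cos θ * y' - Real.sin θ * y : ℝ) : ℂ) = 0) : r = 0 := by
  have h1 : r * (X ^ 2 - C ((y ^ 2 + y' ^ 2 : ℝ) : ℂ)) = 0 := by
    refine polynomial_eq_zero_of_Icc hy fun v hv => ?_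
    obtain ⟨θ, rfl⟩ := exists_rotation_eq y y' hv
    have e : ((Real.sin θ * y' + Real.cos θ * y : ℝ) : ℂ) ^ 2 - ((y ^ 2 + y' ^ 2 : ℝ) : ℂ) =
        -((Real.cos θ * y' - Real.sin θ * y : ℝ) : ℂ) ^ 2 := by
      norm_cast
      linear_combination (y ^ 2 + y' ^ 2) * Real.sin_sq_add_cos_sq θ
    rw [eval_mul, eval_sub, eval_pow, eval_X, eval_C, e]
    linear_combination -((Real.cos θ * y' - Real.sin θ * y : ℝ) : ℂ) * h θ
  refine (mul_eq_zero.1 h1).resolve_right (X_pow_sub_C_ne_zero two_pos _)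

theorem polynomial_coeff_eq_zero_of_rotation {r : ℂ[X]} {y y' : ℝ} (hy : y ≠ 0) {a : ℂ}
    (h : ∀ θ : ℝ, r.eval ((Real.sin θ * y' + Real.cos θ * y : ℝ) : ℂ) = a) {k : ℕ} (hk : k ≠ 0) :
    r.coeff k = 0 := by
  have h1 : r - C a = 0 := by
    refine polynomial_eq_zero_of_Icc hy fun v hv => ?_
    obtain ⟨θ, rfl⟩ := exists_rotation_eq y y' hv
    rw [eval_sub, eval_C, h, sub_self]
  rw [sub_eq_zero.1 h1, coeff_C_of_ne_zero hk]

/-- Rotation by the angle `θ` in the plane of the first two members of a family. -/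
noncomputable def rotate {n : ℕ} (θ : ℝ) (s : Fin (n + 2) → 𝓢(ℝ, ℝ)) : Fin (n + 2) → 𝓢(ℝ, ℝ) :=
  Fin.cons (Real.cos θ • s 0 - Real.sin θ • s 1)
    (Fin.cons (Real.sin θ • s 0 + Real.cos θ • s 1) fun j => s j.succ.succ)

theorem orthonormal_rotate {n : ℕ} (θ : ℝ) {s : Fin (n + 2) → 𝓢(ℝ, ℝ)}
    (hs : Orthonormal ℝ fun i => schwartzToL2 (s i)) :
    Orthonormal ℝ fun i => schwartzToL2 (rotate θ s i) := by
  have h := orthonormal_iff_ite.1 hs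
  have hsc := Real.sin_sq_add_cos_sq θ
  have e0 : rotate θ s 0 = Real.cos θ • s 0 - Real.sin θ • s 1 := rfl
  have e1 : rotate θ s (Fin.succ 0) = Real.sin θ • s 0 + Real.cos θ • s 1 := rfl
  have e2 : ∀ j : Fin n, rotate θ s j.succ.succ = s j.succ.succ := fun j => rfl
  have hne : ∀ j : Fin n, (1 : Fin (n + 2)) ≠ j.succ.succ := fun j hj => by
    rw [← Fin.succ_zero_eq_one, Fin.succ_inj] at hj
    exact (Fin.succ_ne_zero j) hj.symm
  rw [orthonormal_iff_ite]
  intro i j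
  refine Fin.cases ?_ (fun i => Fin.cases ?_ (fun i => ?_) i) i <;>
    refine Fin.cases ?_ (fun j => Fin.cases ?_ (fun j => ?_) j) j
  all_goals
    simp only [e0, e1, e2, map_add, map_sub, map_smul, inner_add_left, inner_add_right,
      inner_sub_left, inner_sub_right, real_inner_smul_left, real_inner_smul_right, h]
    try simp [hne, (hne _).symm, Fin.succ_ne_zero, (Fin.succ_ne_zero _).symm]
  all_goals nlinarith

theorem continuous_eval_ofReal {σ : Type*} (q : MvPolynomial σ ℂ) :
    Continuous fun x : σ → ℝ => MvPolynomial.eval (fun j => (x j : ℂ)) q :=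
  (MvPolynomial.continuous_eval q).comp (by fun_prop)

/-- The coordinate vector of the rotated family. -/
theorem Q_rotate_succ {n : ℕ} (θ : ℝ) (s : Fin (n + 2) → 𝓢(ℝ, ℝ)) (T : RealDistribution) :
    (fun j : Fin (n + 1) => (Q (rotate θ s j.succ) T : ℂ)) =
      Fin.cons ((Real.sin θ * Q (s 0) T + Real.cos θ * Q (s 1) T : ℝ) : ℂ)
        fun j : Fin n => (Q (s j.succ.succ) T : ℂ) := by
  funext j
  refine Fin.cases ?_ (fun j => ?_) j
  · change ((Q (Real.sin θ • s 0 + Real.cos θ • s 1) T : ℝ) : ℂ) = _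
    rw [Q_add, Q_smul, Q_smul]
    rfl
  · rfl

theorem Q_rotate_zero {n : ℕ} (θ : ℝ) (s : Fin (n + 2) → 𝓢(ℝ, ℝ)) (T : RealDistribution) :
    Q (rotate θ s 0) T = Real.cos θ * Q (s 0) T - Real.sin θ * Q (s 1) T := by
  change Q (Real.cos θ • s 0 - Real.sin θ • s 1) T = _
  rw [Q_sub, Q_smul, Q_smul]

theorem forall_real_of_forall_rat {F G : ℝ → ℂ} (hF : Continuous F) (hG : Continuous G)
    (h : ∀ r : ℚ, F r = G r) (x : ℝ) : F x = G x :=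
  congrFun (Rat.isDenseEmbedding_coe_real.dense.equalizer hF hG (funext h)) x

/-- A polynomial in coordinates `Q (s 1), …, Q (s n)` which vanishes almost surely where
`Q (s 0) ≠ 0` is zero. -/
theorem eq_zero_of_ae_eval_mul_Q (hφ : IsML φ) (hP : IsPφ φ P) (n : ℕ)
    (s : Fin (n + 1) → 𝓢(ℝ, ℝ)) (hs : Orthonormal ℝ fun i => schwartzToL2 (s i))
    (q : MvPolynomial (Fin n) ℂ)
    (h : ∀ᵐ T ∂P, MvPolynomial.eval (fun j => (Q (s j.succ) T : ℂ)) q * (Q (s 0) T : ℂ) = 0) :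
    q = 0 := by
  induction n with
  | zero =>
    rw [MvPolynomial.eq_C_of_isEmpty q] at h ⊢
    by_contra hq
    refine not_ae_Q_eq_zero hφ hP (hs.1 0) ?_
    filter_upwards [h] with T hT
    rw [MvPolynomial.eval_C] at hT
    have := (mul_eq_zero.1 hT).resolve_left fun h => hq (by rw [h, map_zero])
    exact_mod_cast this
  | succ n ih =>
    -- Rational angles keep the exceptional set null; continuity in the angle recovers all real ones
    -- for a fixed T.
    have hrot : ∀ᵐ T ∂P, ∀ r : ℚ, MvPolynomial.eval
        (fun j => (Q (rotate (r : ℝ) s j.succ) T : ℂ)) q * (Q (rotate (r : ℝ) s 0) T : ℂ) = 0 := by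
      rw [ae_all_iff]
      intro r
      refine ae_iff_of_orthonormal hP hs (orthonormal_rotate r hs) (p := fun x =>
        MvPolynomial.eval (fun j : Fin (n + 1) => (x j.succ : ℂ)) q * (x 0 : ℂ) = 0) ?_ h
      refine (isClosed_eq (Continuous.mul ?_ (by fun_prop)) continuous_const).measurableSet
      exact (continuous_eval_ofReal q).comp (f := fun (x : Fin (n + 2) → ℝ) (j : Fin (n + 1)) =>
        x j.succ) (by fun_prop)
    have hcoeff : ∀ k, (MvPolynomial.finSuccEquiv ℂ n q).coeff k = 0 := by
      intro k
      refine ih (fun j => s j.succ) (hs.comp _ (Fin.succ_injective _)) _ ?_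
      filter_upwards [hrot] with T hT
      -- The factor `Q (s 1)` now plays the role of `Q (s 0)` for the shorter family, so nothing is
      -- needed where it vanishes.
      by_cases hy : Q (s 1) T = 0
      · simp [hy]
      have h2 : Polynomial.map (MvPolynomial.eval fun j : Fin n => (Q (s j.succ.succ) T : ℂ))
          (MvPolynomial.finSuccEquiv ℂ n q) = 0 := by
        refine polynomial_eq_zero_of_rotation (y' := Q (s 0) T) hy ?_
        refine forall_real_of_forall_rat (by fun_prop) continuous_const fun r => ?_
        have h3 := hT r
        rw [Q_rotate_succ, Q_rotate_zero, MvPolynomial.eval_eq_eval_mv_eval'] at h3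
        exact h3
      have h4 := congrArg (fun p => p.coeff k) h2
      simp only [coeff_map, coeff_zero] at h4
      rw [h4, zero_mul]
    have h5 : MvPolynomial.finSuccEquiv ℂ n q = 0 := by ext1 k; rw [hcoeff, coeff_zero]
    simpa using h5

/-- A polynomial in the coordinates `Q (s 1), …, Q (s (n + 1))` which is an `L²`-limit of
polynomials in `Q (s 2), …, Q (s (n + 1))` does not depend on its first variable. -/
theorem coeff_finSuccEquiv_eq_zero (hφ : IsML φ) (hP : IsPφ φ P) (n : ℕ)
    (s : Fin (n + 2) → 𝓢(ℝ, ℝ)) (hs : Orthonormal ℝ fun i => schwartzToL2 (s i))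
    (q : MvPolynomial (Fin (n + 1)) ℂ)
    (h : ∀ ε : ENNReal, ε ≠ 0 → ∃ g : MvPolynomial (Fin n) ℂ,
      eLpNorm (fun T => MvPolynomial.eval (fun j => (Q (s j.succ) T : ℂ)) q -
        MvPolynomial.eval (fun j => (Q (s j.succ.succ) T : ℂ)) g) 2 P ≤ ε) {k : ℕ} (hk : k ≠ 0) :
    (MvPolynomial.finSuccEquiv ℂ n q).coeff k = 0 := by
  have hm : ∀ s : Fin (n + 2) → 𝓢(ℝ, ℝ), Measurable fun T i => Q (s i) T := fun s =>
    measurable_pi_lambda _ fun i => measurable_Q _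
  -- The rotation preserves the joint law and does not touch the variables of g, so g is as close to
  -- the rotated q as to q itself.
  have hinv : ∀ θ : ℝ, (fun T => MvPolynomial.eval (fun j => (Q (rotate θ s j.succ) T : ℂ)) q)
      =ᵐ[P] fun T => MvPolynomial.eval (fun j => (Q (s j.succ) T : ℂ)) q := by
    intro θ
    have hms : ∀ s : Fin (n + 2) → 𝓢(ℝ, ℝ), Measurable
        fun T => MvPolynomial.eval (fun j : Fin (n + 1) => (Q (s j.succ) T : ℂ)) q := fun s =>
      (continuous_eval_ofReal q).measurable.comp
        (measurable_pi_lambda _ fun i => measurable_Q (s i.succ))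
    have hmg : ∀ g : MvPolynomial (Fin n) ℂ, Measurable
        fun T => MvPolynomial.eval (fun j : Fin n => (Q (s j.succ.succ) T : ℂ)) g := fun g =>
      (continuous_eval_ofReal g).measurable.comp
        (measurable_pi_lambda _ fun i => measurable_Q (s i.succ.succ))
    have hz : eLpNorm (fun T => MvPolynomial.eval (fun j => (Q (rotate θ s j.succ) T : ℂ)) q -
        MvPolynomial.eval (fun j => (Q (s j.succ) T : ℂ)) q) 2 P = 0 := by
      rw [← nonpos_iff_eq_zero]
      refine le_of_forall_pos_le_add fun ε hε => ?_
      obtain ⟨g, hg⟩ := h (ε / 2) (by simpa using hε.ne')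
      have hg' : eLpNorm (fun T => MvPolynomial.eval (fun j => (Q (rotate θ s j.succ) T : ℂ)) q -
          MvPolynomial.eval (fun j => (Q (s j.succ.succ) T : ℂ)) g) 2 P ≤ ε / 2 := by
        refine le_of_eq_of_le ?_ hg
        set F : (Fin (n + 2) → ℝ) → ℂ := fun x =>
          MvPolynomial.eval (fun j : Fin (n + 1) => (x j.succ : ℂ)) q -
            MvPolynomial.eval (fun j : Fin n => (x j.succ.succ : ℂ)) g with hF
        have hFm : Continuous F :=
          ((continuous_eval_ofReal q).comp (f := fun (x : Fin (n + 2) → ℝ) (j : Fin (n + 1)) =>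
            x j.succ) (by fun_prop)).sub
          ((continuous_eval_ofReal g).comp (f := fun (x : Fin (n + 2) → ℝ) (j : Fin n) =>
            x j.succ.succ) (by fun_prop))
        have h1 := eLpNorm_map_measure (p := 2) (μ := P)
          hFm.measurable.aestronglyMeasurable (hm (rotate θ s)).aemeasurable
        have h2 := eLpNorm_map_measure (p := 2) (μ := P)
          hFm.measurable.aestronglyMeasurable (hm s).aemeasurable
        rw [map_Q_eq_of_orthonormal hP (orthonormal_rotate θ hs) hs] at h1
        exact h1.symm.trans h2
      rw [zero_add, ← ENNReal.add_halves ε]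
      refine le_trans ?_ (add_le_add hg' hg)
      refine le_of_eq_of_le ?_ (eLpNorm_sub_le
        ((hms (rotate θ s)).sub (hmg g)).aestronglyMeasurable
        ((hms s).sub (hmg g)).aestronglyMeasurable one_le_two)
      congr 1
      funext T
      simp
    have hz' := (eLpNorm_eq_zero_iff
      ((hms (rotate θ s)).sub (hms s)).aestronglyMeasurable two_ne_zero).1 hz
    filter_upwards [hz'] with T hT
    exact sub_eq_zero.1 hT
  have hrot : ∀ᵐ T ∂P, ∀ r : ℚ, MvPolynomial.eval
      (fun j => (Q (rotate (r : ℝ) s j.succ) T : ℂ)) q =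
        MvPolynomial.eval (fun j => (Q (s j.succ) T : ℂ)) q :=
    ae_all_iff.2 fun r => hinv r
  refine eq_zero_of_ae_eval_mul_Q hφ hP n (fun j => s j.succ)
    (hs.comp _ (Fin.succ_injective _)) _ ?_
  filter_upwards [hrot] with T hT
  by_cases hy : Q (s 1) T = 0
  · simp [hy]
  have h2 : (Polynomial.map (MvPolynomial.eval fun j : Fin n => (Q (s j.succ.succ) T : ℂ))
      (MvPolynomial.finSuccEquiv ℂ n q)).coeff k = 0 := by
    refine polynomial_coeff_eq_zero_of_rotation (y' := Q (s 0) T) hy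
      (a := MvPolynomial.eval (fun j => (Q (s j.succ) T : ℂ)) q) ?_ hk
    refine forall_real_of_forall_rat (by fun_prop) continuous_const fun r => ?_
    rw [← hT r, Q_rotate_succ, MvPolynomial.eval_eq_eval_mv_eval']
  rw [coeff_map] at h2
  rw [h2, zero_mul]

theorem polyL2_injective (hφ : IsML φ) (hP : IsPφ φ P) : Function.Injective (polyL2 hφ hP) := by
  rw [injective_iff_map_eq_zero]
  intro p hp
  obtain ⟨n, f, hf, q, rfl⟩ := MvPolynomial.exists_fin_rename p
  -- An unused coordinate supplies the extra factor `Q (s 0)` required by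
  -- `eq_zero_of_ae_eval_mul_Q`.
  obtain ⟨j, hj⟩ := (Set.finite_range f).exists_notMem
  have hinj : Function.Injective (Fin.cons j f : Fin (n + 1) → ℕ) :=
    Fin.cons_injective_iff.2 ⟨hj, hf⟩
  have hq : q = 0 := by
    refine eq_zero_of_ae_eval_mul_Q hφ hP n
      (fun i => hermiteFun ((Fin.cons j f : Fin (n + 1) → ℕ) i))
      (orthonormal_hermiteFun.comp _ hinj) q ?_
    have h0 := (Lp.eq_zero_iff_ae_eq_zero).1 hp
    filter_upwards [h0, coeFn_polyL2 hφ hP (MvPolynomial.rename f q)] with T h1 h2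
    rw [h2, MvPolynomial.eval_rename] at h1
    have h3 : MvPolynomial.eval (fun i => (Q (hermiteFun (f i)) T : ℂ)) q = 0 := h1
    simp only [Fin.cons_succ, h3, zero_mul]
  rw [hq, map_zero]

/-- A polynomial in the first `n + 1` coordinates which vanishes for `x_n = 0` and is an
`L²`-limit of polynomials in the first `n` coordinates is zero. -/
theorem eq_zero_of_polyL2_mem_closure (hφ : IsML φ) (hP : IsPφ φ P) (n : ℕ)
    {p : MvPolynomial ℕ ℂ} (hp : p ∈ MvPolynomial.supported ℂ (Set.Iic n))
    (hp0 : ∀ x : ℕ → ℂ, x n = 0 → MvPolynomial.eval x p = 0)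
    (h : polyL2 hφ hP p ∈ closure
      (polyL2 hφ hP '' (MvPolynomial.supported ℂ (Set.Iio n) : Set (MvPolynomial ℕ ℂ)))) :
    p = 0 := by
  -- Variable n is listed first because `finSuccEquiv` singles out variable 0; the index n + 1 then
  -- serves as the fresh direction of rotation.
  set f : Fin (n + 1) → ℕ := Fin.cons n fun j : Fin n => (j : ℕ) with hf_def
  have hf : Function.Injective f := Fin.cons_injective_iff.2
    ⟨by rintro ⟨j, hj⟩; exact j.2.ne hj, Fin.val_injective⟩
  have hf' : Function.Injective (Fin.cons (n + 1) f : Fin (n + 2) → ℕ) := by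
    refine Fin.cons_injective_iff.2 ⟨?_, hf⟩
    rintro ⟨j, hj⟩
    revert hj
    refine Fin.cases ?_ (fun j => ?_) j
    · simp [hf_def]
    · simp only [hf_def, Fin.cons_succ]
      have := j.2
      omega
  obtain ⟨q, rfl⟩ := MvPolynomial.exists_rename_eq_of_vars_subset_range p f hf (by
    refine (MvPolynomial.mem_supported.1 hp).trans fun i hi => ?_
    rcases (Set.mem_Iic.1 hi).lt_or_eq with h | rfl
    · exact ⟨Fin.succ ⟨i, h⟩, rfl⟩
    · exact ⟨0, rfl⟩)
  have hcoeff : ∀ k, (MvPolynomial.finSuccEquiv ℂ n q).coeff k = 0 := by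
    intro k
    by_cases hk : k = 0
    -- The constant coefficient is the restriction to x_n = 0, killed by `hp0`; the higher ones
    -- vanish by rotation invariance.
    · subst hk
      refine MvPolynomial.funext fun x => ?_
      have h1 := hp0 (fun i => if hi : i < n then x ⟨i, hi⟩ else 0) (by simp)
      rw [MvPolynomial.eval_rename] at h1
      have e : (fun i => if hi : i < n then x ⟨i, hi⟩ else 0) ∘ f = Fin.cons 0 x := by
        funext j
        refine Fin.cases ?_ (fun j => ?_) j
        · simp [hf_def]
        · simp [hf_def]
      rw [e, MvPolynomial.eval_eq_eval_mv_eval', ← coeff_zero_eq_eval_zero, coeff_map] at h1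
      rw [h1, map_zero]
    refine coeff_finSuccEquiv_eq_zero hφ hP n
      (fun i => hermiteFun ((Fin.cons (n + 1) f : Fin (n + 2) → ℕ) i))
      (orthonormal_hermiteFun.comp _ hf') q (fun ε hε => ?_) hk
    obtain ⟨_, ⟨g, hg, rfl⟩, hgε⟩ := EMetric.mem_closure_iff.1 h ε (pos_iff_ne_zero.2 hε)
    obtain ⟨g, rfl⟩ := MvPolynomial.exists_rename_eq_of_vars_subset_range g
      (fun j : Fin n => (j : ℕ)) Fin.val_injective (by
        refine (MvPolynomial.mem_supported.1 hg).trans fun i hi => ⟨⟨i, hi⟩, rfl⟩)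
    refine ⟨g, ?_⟩
    rw [Lp.edist_def] at hgε
    refine le_of_eq_of_le (eLpNorm_congr_ae ?_) hgε.le
    filter_upwards [coeFn_polyL2 hφ hP (MvPolynomial.rename f q),
      coeFn_polyL2 hφ hP (MvPolynomial.rename (fun j : Fin n => (j : ℕ)) g)] with T h1 h2
    rw [Pi.sub_apply, h1, h2, MvPolynomial.eval_rename, MvPolynomial.eval_rename]
    rfl
  have h5 : MvPolynomial.finSuccEquiv ℂ n q = 0 := by ext1 k; rw [hcoeff, coeff_zero]
  have h6 : q = 0 := by simpa using h5
  rw [h6, map_zero]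

/-! ### Expansions along orthonormal bases -/

theorem IsOrthonormalBasis.existsUnique_hasSum {ι E : Type*} [NormedAddCommGroup E]
    [InnerProductSpace ℂ E] [CompleteSpace E] {v : ι → E} (hv : IsOrthonormalBasis v) (f : E) :
    ∃! c : ι → ℂ, HasSum (fun i => c i • v i) f := by
  classical
  have h := (HilbertBasis.mk hv.1 hv.2.ge).hasSum_repr f
  rw [HilbertBasis.coe_mk] at h
  refine ⟨_, h, fun c hc => ?_⟩
  have key : ∀ d : ι → ℂ, HasSum (fun i => d i • v i) f → ∀ i, d i = inner ℂ (v i) f := by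
    intro d hd i
    have h1 := hd.mapL (innerSL ℂ (v i))
    have h2 : HasSum (fun j => inner ℂ (v i) (d j • v j)) (d i) := by
      have := hasSum_single (f := fun j => inner ℂ (v i) (d j • v j)) i fun j hj => by
        rw [inner_smul_right, hv.1.2 hj.symm, mul_zero]
      rwa [inner_smul_right, inner_self_eq_norm_sq_to_K, hv.1.1 i, RCLike.ofReal_one, one_pow,
        mul_one] at this
    exact h2.unique h1
  funext i
  rw [key c hc i, key _ h i]

theorem linearIndependent_monomialL2 (hφ : IsML φ) (hP : IsPφ φ P) :
    LinearIndependent ℂ (monomialL2 P) := by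
  have h := (MvPolynomial.basisMonomials ℕ ℂ).linearIndependent.map' (polyL2 hφ hP)
    (LinearMap.ker_eq_bot.2 (polyL2_injective hφ hP))
  have e : polyL2 hφ hP ∘ MvPolynomial.basisMonomials ℕ ℂ = monomialL2 P := by
    funext γ
    rw [Function.comp_apply, MvPolynomial.coe_basisMonomials, polyL2_monomial]
  rwa [e] at h

theorem isOrthonormalBasis_QtildePoly (hφ : IsML φ) (hP : IsPφ φ P) (e : ℕ ≃ (ℕ →₀ ℕ)) :
    IsOrthonormalBasis (QtildePoly P e) := by
  refine ⟨?_, ?_⟩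
  · exact (InnerProductSpace.gramSchmidtNormed_orthonormal
      ((linearIndependent_monomialL2 hφ hP).comp e e.injective)).comp _ e.symm.injective
  · have hr : Set.range (QtildePoly P e) =
        Set.range (InnerProductSpace.gramSchmidtNormed ℂ fun k => monomialL2 P (e k)) :=
      e.symm.surjective.range_comp _
    rw [hr, InnerProductSpace.span_gramSchmidtNormed_range,
      InnerProductSpace.span_gramSchmidt, ← topologicalClosure_span_monomialL2 hφ hP]
    congr 2
    exact e.surjective.range_comp (monomialL2 P)

/-! ### The stages -/

/-- The closed span of the monomials of the stages before stage `n`. -/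
noncomputable def monomialsBefore (P : Measure RealDistribution) (n : ℕ) :
    Submodule ℂ (Lp ℂ 2 P) :=
  (Submodule.span ℂ (monomialL2 P '' {γ | stage γ < n})).topologicalClosure

theorem monomialL2_mem_monomialsBefore {n : ℕ} {γ : ℕ →₀ ℕ} (h : stage γ < n) :
    monomialL2 P γ ∈ monomialsBefore P n :=
  Submodule.le_topologicalClosure _ (Submodule.subset_span ⟨γ, h, rfl⟩)

theorem monomialsBefore_mono {m n : ℕ} (h : m ≤ n) : monomialsBefore P m ≤ monomialsBefore P n :=
  Submodule.topologicalClosure_mono (Submodule.span_mono (Set.image_mono fun _ hγ =>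
    lt_of_lt_of_le hγ h))

theorem monomialsBefore_zero : monomialsBefore P 0 = ⊥ :=
  le_bot_iff.1 (Submodule.topologicalClosure_minimal _ (by simp) isClosed_singleton)

theorem isClosed_previousStages (e : StageEnumeration) (n : ℕ) :
    IsClosed (previousStages P e n : Set (Lp ℂ 2 P)) := by
  cases n with
  | zero => exact isClosed_singleton
  | succ n => exact Submodule.isClosed_topologicalClosure _

theorem previousStages_mono (e : StageEnumeration) : Monotone (previousStages P e) :=
  monotone_nat_of_le_succ fun _ => le_sup_left.trans (Submodule.le_topologicalClosure _)

theorem sub_starProjection_orthogonal_mem {S : Submodule ℂ (Lp ℂ 2 P)}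
    (hS : IsClosed (S : Set (Lp ℂ 2 P))) (v : Lp ℂ 2 P) : v - Sᗮ.starProjection v ∈ S := by
  have h := Submodule.sub_starProjection_mem_orthogonal (K := Sᗮ) v
  rwa [Submodule.orthogonal_orthogonal_eq_closure, hS.submodule_topologicalClosure_eq] at h

theorem span_stageFamily (S : Submodule ℂ (Lp ℂ 2 P)) {n : ℕ}
    (e : ℕ ≃ {γ : ℕ →₀ ℕ // stage γ = n}) :
    Submodule.span ℂ (Set.range (stageFamily P S e)) =
      Submodule.span ℂ (Set.range fun k => Sᗮ.starProjection (monomialL2 P (e k).1)) := by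
  rw [stageFamily, InnerProductSpace.span_gramSchmidtNormed_range,
    InnerProductSpace.span_gramSchmidt]

/-- Projecting a monomial changes it only by an element of the closed previous space, and
Gram–Schmidt preserves spans. No independence is needed. -/
theorem previousStages_eq (e : StageEnumeration) (n : ℕ) :
    previousStages P e n = monomialsBefore P n := by
  induction n with
  | zero =>
    rw [previousStages, monomialsBefore_zero]
  | succ n ih =>
    have hS := isClosed_previousStages (P := P) e n
    have hproj := fun k => sub_starProjection_orthogonal_mem hS (monomialL2 P (e n k).1)
    apply le_antisymm
    · rw [previousStages]
      refine Submodule.topologicalClosure_minimal _ (sup_le ?_ ?_)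
        (Submodule.isClosed_topologicalClosure _)
      · rw [ih]
        exact monomialsBefore_mono n.le_succ
      · rw [span_stageFamily, Submodule.span_le]
        rintro _ ⟨k, rfl⟩
        have h1 : monomialL2 P (e n k).1 ∈ monomialsBefore P (n + 1) :=
          monomialL2_mem_monomialsBefore (by rw [(e n k).2]; exact n.lt_succ_self)
        have h2 := monomialsBefore_mono n.le_succ (ih.le (hproj k))
        have h3 := Submodule.sub_mem _ h1 h2
        rwa [sub_sub_cancel] at h3
    · refine Submodule.topologicalClosure_minimal _ ?_ (isClosed_previousStages e (n + 1))
      rw [Submodule.span_le]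
      rintro _ ⟨γ, hγ, rfl⟩
      rcases (Nat.lt_succ_iff.1 hγ).lt_or_eq with h | h
      · have h1 : monomialL2 P γ ∈ previousStages P e n := by
          rw [ih]
          exact monomialL2_mem_monomialsBefore h
        exact previousStages_mono e n.le_succ h1
      · obtain ⟨k, hk⟩ := (e n).surjective ⟨γ, h⟩
        have h1 := previousStages_mono e n.le_succ (hproj k)
        have h2 : (previousStages P e n)ᗮ.starProjection (monomialL2 P (e n k).1) ∈
            previousStages P e (n + 1) := by
          refine Submodule.le_topologicalClosure _ (Submodule.mem_sup_right ?_)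
          rw [span_stageFamily]
          exact Submodule.subset_span ⟨k, rfl⟩
        have h3 := Submodule.add_mem _ h1 h2
        rwa [sub_add_cancel, hk] at h3

theorem apply_eq_zero_of_stage_lt {γ : ℕ →₀ ℕ} {j : ℕ} (h : stage γ < j) : γ j = 0 := by
  by_contra hj
  exact absurd (Finset.le_sup (f := id) (Finsupp.mem_support_iff.2 hj)) (not_le.2 h)

theorem apply_stage_ne_zero {γ : ℕ →₀ ℕ} (h : stage γ ≠ 0) : γ (stage γ) ≠ 0 := by
  have hne : γ.support.Nonempty := by
    rw [Finset.nonempty_iff_ne_empty]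
    intro h0
    exact h (by rw [stage, h0]; rfl)
  obtain ⟨j, hj, hj'⟩ := Finset.exists_mem_eq_sup γ.support hne id
  have : stage γ = j := hj'
  rw [this]
  exact Finsupp.mem_support_iff.1 hj

theorem monomial_mem_supported {γ : ℕ →₀ ℕ} {A : Set ℕ} (h : ∀ j, j ∉ A → γ j = 0) :
    MvPolynomial.monomial γ (1 : ℂ) ∈ MvPolynomial.supported ℂ A := by
  rw [MvPolynomial.mem_supported, MvPolynomial.vars_monomial one_ne_zero]
  intro j hj
  by_contra hA
  exact Finsupp.mem_support_iff.1 hj (h j hA)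

/-- The kernel of the projection is the closed span of the earlier monomials, so the span of the
stage n monomials must meet that closure trivially. This is what makes every normalized Gram–Schmidt
vector a unit vector. -/
theorem linearIndependent_stage_projections (hφ : IsML φ) (hP : IsPφ φ P) (n : ℕ)
    (e : ℕ ≃ {γ : ℕ →₀ ℕ // stage γ = n}) :
    LinearIndependent ℂ fun k =>
      (monomialsBefore P n)ᗮ.starProjection (monomialL2 P (e k).1) := by
  have hli : LinearIndependent ℂ fun k => monomialL2 P (e k).1 :=
    (linearIndependent_monomialL2 hφ hP).comp _ (Subtype.val_injective.comp e.injective)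
  refine hli.map (f := ((monomialsBefore P n)ᗮ.starProjection).toLinearMap) ?_
  rw [Submodule.disjoint_def]
  intro x hx hx0
  have hxS : x ∈ monomialsBefore P n := by
    have h := sub_starProjection_orthogonal_mem (S := monomialsBefore P n)
      (Submodule.isClosed_topologicalClosure _) x
    have h0 : (monomialsBefore P n)ᗮ.starProjection x = 0 := hx0
    rwa [h0, sub_zero] at h
  -- Stage 0 contains the constant monomial, which does not vanish at x_0 = 0; there the earlier
  -- space is trivial and nothing has to be shown.
  rcases Nat.eq_zero_or_pos n with rfl | hn
  · rwa [monomialsBefore_zero, Submodule.mem_bot] at hxS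
  have hspan : ∀ A : Set (ℕ →₀ ℕ), Submodule.span ℂ (monomialL2 P '' A) =
      (Submodule.span ℂ ((fun γ => MvPolynomial.monomial γ (1 : ℂ)) '' A)).map (polyL2 hφ hP) := by
    intro A
    rw [Submodule.map_span, ← Set.image_comp]
    congr 2
    funext γ
    exact (polyL2_monomial hφ hP γ).symm
  have hx' : x ∈ Submodule.span ℂ (monomialL2 P '' {γ | stage γ = n}) := by
    refine Submodule.span_mono ?_ hx
    rintro _ ⟨k, rfl⟩
    exact ⟨(e k).1, (e k).2, rfl⟩
  rw [hspan] at hx'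
  obtain ⟨p, hp, rfl⟩ := hx'
  have hp0 : p = 0 := by
    refine eq_zero_of_polyL2_mem_closure hφ hP n ?_ ?_ ?_
    · refine (Submodule.span_le (p := Subalgebra.toSubmodule
        (MvPolynomial.supported ℂ (Set.Iic n)))).2 ?_ hp
      rintro _ ⟨γ, hγ, rfl⟩
      exact monomial_mem_supported fun j hj =>
        apply_eq_zero_of_stage_lt (lt_of_eq_of_lt hγ (not_le.1 hj))
    · intro y hy
      refine (Submodule.span_le (p := LinearMap.ker (MvPolynomial.aeval y).toLinearMap)).2 ?_ hp
      rintro _ ⟨γ, hγ, rfl⟩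
      have hγ' : stage γ = n := hγ
      have h1 : γ n ≠ 0 := hγ' ▸ apply_stage_ne_zero (by omega)
      change MvPolynomial.eval y _ = 0
      rw [MvPolynomial.eval_monomial, one_mul]
      exact Finset.prod_eq_zero (Finsupp.mem_support_iff.2 h1) (by simp only [hy, zero_pow h1])
    · refine closure_mono ?_ hxS
      rw [hspan]
      rintro _ ⟨q, hq, rfl⟩
      refine ⟨q, ?_, rfl⟩
      refine (Submodule.span_le (p := Subalgebra.toSubmodule
        (MvPolynomial.supported ℂ (Set.Iio n)))).2 ?_ hq
      rintro _ ⟨γ, hγ, rfl⟩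
      refine monomial_mem_supported fun j hj => apply_eq_zero_of_stage_lt ?_
      exact lt_of_lt_of_le hγ (not_lt.1 hj)
  rw [hp0, map_zero]

theorem Qtilde_eq (e : StageEnumeration) {n : ℕ} {γ : ℕ →₀ ℕ} (h : stage γ = n) :
    Qtilde P e γ = stageFamily P (previousStages P e n) (e n) ((e n).symm ⟨γ, h⟩) := by
  subst h
  rfl

theorem orthonormal_stageFamily (hφ : IsML φ) (hP : IsPφ φ P) (e : StageEnumeration) (n : ℕ) :
    Orthonormal ℂ (stageFamily P (previousStages P e n) (e n)) := by
  rw [previousStages_eq]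
  exact InnerProductSpace.gramSchmidtNormed_orthonormal
    (linearIndependent_stage_projections hφ hP n (e n))

theorem Qtilde_mem_previousStages (e : StageEnumeration) {n : ℕ} {γ : ℕ →₀ ℕ}
    (h : stage γ < n) : Qtilde P e γ ∈ previousStages P e n := by
  refine previousStages_mono e h ?_
  exact Submodule.le_topologicalClosure _ (Submodule.mem_sup_right
    (Submodule.subset_span (Set.mem_range_self _)))

theorem Qtilde_mem_orthogonal (e : StageEnumeration) (γ : ℕ →₀ ℕ) :
    Qtilde P e γ ∈ (previousStages P e (stage γ))ᗮ := by
  have h : Qtilde P e γ ∈ Submodule.span ℂ (Set.range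
      (stageFamily P (previousStages P e (stage γ)) (e (stage γ)))) :=
    Submodule.subset_span (Set.mem_range_self _)
  rw [span_stageFamily] at h
  refine Submodule.span_le.2 ?_ h
  rintro _ ⟨k, rfl⟩
  exact Submodule.starProjection_apply_mem _ _

/-- Within a stage orthonormality is that of Gram–Schmidt; across stages the later function is
orthogonal to a space containing the earlier one. The closed span contains each `previousStages`,
hence every monomial. -/
theorem isOrthonormalBasis_Qtilde (hφ : IsML φ) (hP : IsPφ φ P) (e : StageEnumeration) :
    IsOrthonormalBasis (Qtilde P e) := by
  refine ⟨⟨fun γ => (orthonormal_stageFamily hφ hP e _).1 _, fun γ δ hγδ => ?_⟩, ?_⟩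
  · rcases lt_trichotomy (stage γ) (stage δ) with h | h | h
    · exact (Submodule.mem_orthogonal _ _).1 (Qtilde_mem_orthogonal e δ) _
        (Qtilde_mem_previousStages e h)
    · change inner ℂ _ _ = 0
      rw [Qtilde_eq e h, Qtilde_eq e (γ := δ) rfl]
      refine (orthonormal_stageFamily hφ hP e _).2 fun h' => hγδ ?_
      exact congrArg Subtype.val ((e _).symm.injective h')
    · exact (Submodule.mem_orthogonal' _ _).1 (Qtilde_mem_orthogonal e γ) _
        (Qtilde_mem_previousStages e h)
  · rw [eq_top_iff, ← topologicalClosure_span_monomialL2 hφ hP]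
    refine Submodule.topologicalClosure_minimal _ ?_ (Submodule.isClosed_topologicalClosure _)
    have hprev : ∀ n, previousStages P e n ≤
        (Submodule.span ℂ (Set.range (Qtilde P e))).topologicalClosure := by
      intro n
      induction n with
      | zero => exact bot_le
      | succ n ih =>
        refine Submodule.topologicalClosure_minimal _ (sup_le ih ?_)
          (Submodule.isClosed_topologicalClosure _)
        refine le_trans (Submodule.span_mono ?_) (Submodule.le_topologicalClosure _)
        rintro _ ⟨k, rfl⟩
        refine ⟨(e n k).1, ?_⟩
        rw [Qtilde_eq e (e n k).2]
        simp
    rw [Submodule.span_le]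
    rintro _ ⟨γ, rfl⟩
    refine hprev (stage γ + 1) ?_
    rw [previousStages_eq]
    exact monomialL2_mem_monomialsBefore (Nat.lt_succ_self _)

end GreyNoise

theorem mainTheorem2 (φ : ℂ → ℂ) (hφ : GreyNoise.IsML φ)
    (P : Measure GreyNoise.RealDistribution) (hP : GreyNoise.IsPφ φ P) :
    (∀ γ : ℕ →₀ ℕ, MemLp (GreyNoise.monomialFun γ) 2 P) ∧
    (∀ e : GreyNoise.StageEnumeration,
      GreyNoise.IsOrthonormalBasis (GreyNoise.Qtilde P e) ∧
      ∀ f : Lp ℂ 2 P, ∃! c : (ℕ →₀ ℕ) → ℂ,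
        HasSum (fun γ => c γ • GreyNoise.Qtilde P e γ) f) ∧
    (∀ e : ℕ ≃ (ℕ →₀ ℕ),
      GreyNoise.IsOrthonormalBasis (GreyNoise.QtildePoly P e) ∧
      ∀ f : Lp ℂ 2 P, ∃! c : (ℕ →₀ ℕ) → ℂ,
        HasSum (fun γ => c γ • GreyNoise.QtildePoly P e γ) f) :=
  ⟨GreyNoise.memLp_monomialFun hφ hP,
    fun e => ⟨GreyNoise.isOrthonormalBasis_Qtilde hφ hP e,
      (GreyNoise.isOrthonormalBasis_Qtilde hφ hP e).existsUnique_hasSum⟩,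
    fun e => ⟨GreyNoise.isOrthonormalBasis_QtildePoly hφ hP e,
      (GreyNoise.isOrthonormalBasis_QtildePoly hφ hP e).existsUnique_hasSum⟩⟩
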